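/- Let $\mathcal H_A$ be a complex Hilbert space with an orthonormal basis $\{|n\rangle\}_{n=0}^{\infty}$ (the Fock basis), let $\hat n=\sum_{n} n\,|n\rangle\langle n|$ be the number operator, and let $\mathcal H_R$ be a separable complex Hilbert space. Write $\mathfrak T(\mathcal H)$ for the trace-class operators on $\mathcal H$, $\mathfrak S(\mathcal H)$ for the density operators on $\mathcal H$ (positive operators of trace one), $\|T\|_1=\operatorname{Tr}\sqrt{T^\dagger T}\in[0,\infty]$, and $$\mathfrak S_E(\mathcal H_A)=\{\rho\in\mathfrak S(\mathcal H_A):\operatorname{Tr}(\hat n\rho)\le E\}.$$ For a linear map $\Phi:\mathfrak T(\mathcal H_A)\to\mathfrak T(\mathcal H_A)$, a Hilbert space $\mathcal H_{R'}$ and $X\in\mathfrak T(\mathcal H_A\otimes\mathcal H_{R'})$, the operator $(\Phi\otimes\mathrm{Id}_{R'})(X)$ is the bounded operator $Y$ on $\mathcal H_A\otimes\mathcal H_{R'}$ with $(I\otimes\langle e|)\,Y\,(I\otimes|f\rangle)=\Phi\big((I\otimes\langle e|)\,X\,(I\otimes|f\rangle)\big)$ for all $e,f\in\mathcal H_{R'}$;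 it is unique if it exists, and if it does not exist we put $\|(\Phi\otimes\mathrm{Id}_{R'})(X)\|_1=\infty$. The map $\Phi$ is Hermitian-preserving if it maps self-adjoint operators to self-adjoint operators. For $E>0$ its energy-constrained diamond norm is $$\|\Phi\|_\diamond^{E}=\sup\big\{\|(\Phi\otimes\mathrm{Id}_{R'})(\rho)\|_1:\ \rho\in\mathfrak S(\mathcal H_A\otimes\mathcal H_{R'}),\ \operatorname{Tr}_{R'}\rho\in\mathfrak S_E(\mathcal H_A)\big\}\in[0,\infty],\qquad \mathcal H_{R'}=\mathcal H_A .$$ Let $E>0$ and $0<\epsilon<1$, and let $\rho_{AR},\sigma_{AR}$ be density operators on $\mathcal H_A\otimes\mathcal H_R$ whose marginals $\rho_A=\operatorname{Tr}_R\rho_{AR}$ and $\sigma_A=\operatorname{Tr}_R\sigma_{AR}$ lie in $\mathfrak S_E(\mathcal H_A)$ and which satisfy $\|\rho_{AR}-\sigma_{AR}\|_1\le 2\epsilon$. Then for every Hermitian-preserving linear map $\Phi_A:\mathfrak T(\mathcal H_A)\to\mathfrak T(\mathcal H_A)$, $$\big\|(\Phi_A\otimes\mathrm{Id}_R)(\rho_{AR}-\sigma_{AR})\big\|_1\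 \le\ 10\,\epsilon\,\|\Phi_A\|_\diamond^{E/\epsilon^2}.$$ -/

import Mathlib

open scoped ENNReal TensorProduct InnerProductSpace

noncomputable section

/-- The Hilbert-space tensor product: the completion of the algebraic tensor product for the
inner product `⟪a ⊗ r, a' ⊗ r'⟫ = ⟪a, a'⟫ * ⟪r, r'⟫`. -/
abbrev HTensor (A R : Type*) [NormedAddCommGroup A] [InnerProductSpace ℂ A]
    [NormedAddCommGroup R] [InnerProductSpace ℂ R] : Type _ :=
  UniformSpace.Completion (A ⊗[ℂ] R)

/-- The trace, with values in `[0, ∞]`, of a positive bounded operator: the supremum of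
`∑ ⟪x, T x⟫` over all finite orthonormal families. -/
def posTrace {H : Type*} [NormedAddCommGroup H] [InnerProductSpace ℂ H] (T : H →L[ℂ] H) : ℝ≥0∞ :=
  ⨆ (s : Finset H) (_ : Orthonormal ℂ ((↑) : s → H)), ∑ x ∈ s, ENNReal.ofReal (⟪x, T x⟫_ℂ).re

/-- The trace norm `Tr √(T† T)`, with values in `[0, ∞]`. -/
def traceNorm {H : Type*} [NormedAddCommGroup H] [InnerProductSpace ℂ H] [CompleteSpace H]
    (T : H →L[ℂ] H) : ℝ≥0∞ :=
  posTrace (CFC.sqrt (star T * T))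

/-- The space of trace-class operators: the linear span of the positive operators of finite
trace. -/
def traceClass (H : Type*) [NormedAddCommGroup H] [InnerProductSpace ℂ H] :
    Submodule ℂ (H →L[ℂ] H) :=
  Submodule.span ℂ {T | T.IsPositive ∧ posTrace T < ∞}

/-- Density operators: positive operators of trace one. -/
def IsDensity {H : Type*} [NormedAddCommGroup H] [InnerProductSpace ℂ H]
    (ρ : H →L[ℂ] H) : Prop :=
  ρ.IsPositive ∧ posTrace ρ = 1

/-- `Tr (n̂ ρ)` for a positive operator `ρ`, where `n̂ = ∑ n |n⟩⟨n|` in the Fock basis. -/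
def meanPhotonNumber {A : Type*} [NormedAddCommGroup A] [InnerProductSpace ℂ A]
    (fock : HilbertBasis ℕ ℂ A) (ρ : A →L[ℂ] A) : ℝ≥0∞ :=
  ∑' n : ℕ, (n : ℝ≥0∞) * ENNReal.ofReal (⟪fock n, ρ (fock n)⟫_ℂ).re

/-- The set of density operators with mean photon number at most `E`. -/
def energyStates {A : Type*} [NormedAddCommGroup A] [InnerProductSpace ℂ A]
    (fock : HilbertBasis ℕ ℂ A) (E : ℝ) : Set (A →L[ℂ] A) :=
  {ρ | IsDensity ρ ∧ meanPhotonNumber fock ρ ≤ ENNReal.ofReal E}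

section Blocks

variable {A R : Type*} [NormedAddCommGroup A] [InnerProductSpace ℂ A]
  [NormedAddCommGroup R] [InnerProductSpace ℂ R]

/-- The operator `I ⊗ |e⟩ : A → A ⊗ R`, `a ↦ a ⊗ e`. -/
def tensorKet (A : Type*) [NormedAddCommGroup A] [InnerProductSpace ℂ A] (e : R) :
    A →L[ℂ] HTensor A R :=
  UniformSpace.Completion.toComplL.comp ((TensorProduct.mkL ℂ A R).flip e)

theorem tensorKet_apply (e : R) (a : A) :
    tensorKet A e a = ((a ⊗ₜ[ℂ] e : A ⊗[ℂ] R) : HTensor A R) := rfl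

theorem tensorKet_add (e f : R) : tensorKet A (e + f) = tensorKet A e + tensorKet A f := by
  ext a
  simp [tensorKet]

theorem tensorKet_smul (c : ℂ) (e : R) : tensorKet A (c • e) = c • tensorKet A e := by
  ext a
  simp [tensorKet]

theorem inner_tensorKet (e f : R) (a b : A) :
    ⟪tensorKet A e a, tensorKet A f b⟫_ℂ = ⟪a, b⟫_ℂ * ⟪e, f⟫_ℂ := by
  simp [tensorKet_apply, UniformSpace.Completion.inner_coe]

variable [CompleteSpace A]

/-- The block `(I ⊗ ⟨e|) X (I ⊗ |f⟩)` of an operator `X` on `A ⊗ R`, an operator on `A`. -/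
def block (X : HTensor A R →L[ℂ] HTensor A R) (e f : R) : A →L[ℂ] A :=
  (ContinuousLinearMap.adjoint (tensorKet A e)).comp (X.comp (tensorKet A f))

theorem inner_block (X : HTensor A R →L[ℂ] HTensor A R) (e f : R) (a b : A) :
    ⟪a, block X e f b⟫_ℂ = ⟪tensorKet A e a, X (tensorKet A f b)⟫_ℂ := by
  simp [block, ContinuousLinearMap.adjoint_inner_right]

theorem block_isPositive {X : HTensor A R →L[ℂ] HTensor A R} (hX : X.IsPositive) (e : R) :
    (block X e e).IsPositive :=
  hX.adjoint_conj (tensorKet A e)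

theorem posTrace_block_le (X : HTensor A R →L[ℂ] HTensor A R) (e : R) :
    posTrace (block X e e) ≤ ENNReal.ofReal (‖e‖ ^ 2) * posTrace X := by
  classical
  by_cases he : e = 0
  · subst he
    have h0 : tensorKet A (0 : R) = 0 := by
      simpa using tensorKet_smul (A := A) 0 (0 : R)
    simp [posTrace, inner_block, h0]
  have hn : ‖e‖ ≠ 0 := norm_ne_zero_iff.mpr he
  set u : R := ((‖e‖⁻¹ : ℝ) : ℂ) • e with hu
  have hue : e = ((‖e‖ : ℝ) : ℂ) • u := by
    rw [hu, smul_smul, ← Complex.ofReal_mul, mul_inv_cancel₀ hn]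
    simp
  have hunorm : ⟪u, u⟫_ℂ = 1 := by
    have : ‖u‖ = 1 := by
      rw [hu, norm_smul]
      simp [hn]
    rw [inner_self_eq_norm_sq_to_K, this]
    simp
  refine iSup₂_le fun s hs => ?_
  have hinj : Function.Injective (tensorKet A u) := by
    intro a b hab
    have h1 : ⟪tensorKet A u (a - b), tensorKet A u (a - b)⟫_ℂ = 0 := by
      rw [map_sub, hab, sub_self, inner_zero_left]
    rw [inner_tensorKet, hunorm, mul_one, inner_self_eq_zero, sub_eq_zero] at h1
    exact h1
  have ht : Orthonormal ℂ ((↑) : (s.image (tensorKet A u)) → HTensor A R) := by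
    rw [orthonormal_subtype_iff_ite]
    intro v hv w hw
    obtain ⟨a, ha, rfl⟩ := Finset.mem_image.mp hv
    obtain ⟨b, hb, rfl⟩ := Finset.mem_image.mp hw
    rw [inner_tensorKet, hunorm, mul_one, (orthonormal_subtype_iff_ite.mp hs) a ha b hb]
    simp [hinj.eq_iff]
  calc ∑ x ∈ s, ENNReal.ofReal (⟪x, block X e e x⟫_ℂ).re
      = ∑ x ∈ s, ENNReal.ofReal (‖e‖ ^ 2) *
          ENNReal.ofReal (⟪tensorKet A u x, X (tensorKet A u x)⟫_ℂ).re := by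
        refine Finset.sum_congr rfl fun x _ => ?_
        rw [← ENNReal.ofReal_mul (by positivity), inner_block]
        congr 1
        have : tensorKet A e = ((‖e‖ : ℝ) : ℂ) • tensorKet A u := by
          rw [← tensorKet_smul, ← hue]
        rw [this, smul_apply, map_smul, inner_smul_left, inner_smul_right, Complex.conj_ofReal,
          Complex.re_ofReal_mul, Complex.re_ofReal_mul]
        ring
    _ = ENNReal.ofReal (‖e‖ ^ 2) * ∑ y ∈ s.image (tensorKet A u),
          ENNReal.ofReal (⟪y, X y⟫_ℂ).re := by
        rw [Finset.sum_image (fun a _ b _ h => hinj h), Finset.mul_sum]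
    _ ≤ ENNReal.ofReal (‖e‖ ^ 2) * posTrace X := by
        gcongr
        exact le_iSup₂_of_le (s.image (tensorKet A u)) ht le_rfl

theorem block_polarization (X : HTensor A R →L[ℂ] HTensor A R) (e f : R) :
    block X e f = (1 / 4 : ℂ) • (block X (e + f) (e + f)
      + (-1 : ℂ) • block X (e + (-1 : ℂ) • f) (e + (-1 : ℂ) • f)
      + (-Complex.I) • block X (e + Complex.I • f) (e + Complex.I • f)
      + Complex.I • block X (e + (-Complex.I) • f) (e + (-Complex.I) • f)) := by
  refine ContinuousLinearMap.ext fun b => ext_inner_left ℂ fun a => ?_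
  simp only [inner_block, smul_apply, add_apply,
    inner_add_right, inner_smul_right, tensorKet_add, tensorKet_smul, inner_add_left,
    inner_smul_left, map_add, map_smul, map_neg, map_one, Complex.conj_I]
  linear_combination (-(1 / 2 : ℂ) * ⟪tensorKet A e a, X (tensorKet A f b)⟫_ℂ
    + (1 / 2 : ℂ) * ⟪tensorKet A f a, X (tensorKet A e b)⟫_ℂ) * (-Complex.I_sq)

/-- The blocks of a trace-class operator are trace class. -/
theorem block_mem_traceClass {X : HTensor A R →L[ℂ] HTensor A R}
    (hX : X ∈ traceClass (HTensor A R)) (e f : R) : block X e f ∈ traceClass A := by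
  induction hX using Submodule.span_induction with
  | mem X hX =>
    have key : ∀ g : R, block X g g ∈ traceClass A := fun g =>
      Submodule.subset_span ⟨block_isPositive hX.1 g,
        (posTrace_block_le X g).trans_lt (ENNReal.mul_lt_top ENNReal.ofReal_lt_top hX.2)⟩
    rw [block_polarization]
    exact Submodule.smul_mem _ _ (Submodule.add_mem _ (Submodule.add_mem _ (Submodule.add_mem _
      (key _) (Submodule.smul_mem _ _ (key _))) (Submodule.smul_mem _ _ (key _)))
      (Submodule.smul_mem _ _ (key _)))
  | zero =>
    have : block (0 : HTensor A R →L[ℂ] HTensor A R) e f = 0 := by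
      ext; simp [block]
    rw [this]
    exact Submodule.zero_mem _
  | add X Y _ _ hX hY =>
    have : block (X + Y) e f = block X e f + block Y e f := by
      ext; simp [block]
    rw [this]
    exact Submodule.add_mem _ hX hY
  | smul c X _ hX =>
    have : block (c • X) e f = c • block X e f := by
      ext; simp [block]
    rw [this]
    exact Submodule.smul_mem _ _ hX

/-- The partial trace over `R` of an operator on `A ⊗ R`, computed in an orthonormal basis `b`
of `R`. For a trace-class operator the series converges in operator norm and its sum
does not depend on `b`. -/
def partialTrace {ι : Type*} (b : HilbertBasis ι ℂ R) (X : HTensor A R →L[ℂ] HTensor A R) :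
    A →L[ℂ] A :=
  ∑' i, block X (b i) (b i)

/-- `Y = (Φ ⊗ Id_R)(X)`: the `R`-blocks of `Y` are the images under `Φ` of the `R`-blocks of `X`.
There is at most one bounded operator `Y` with this property. -/
def IsTensorIdImage (Φ : traceClass A →ₗ[ℂ] traceClass A)
    (X : traceClass (HTensor A R)) (Y : HTensor A R →L[ℂ] HTensor A R) : Prop :=
  ∀ e f : R, block Y e f =
    (Φ ⟨block (X : HTensor A R →L[ℂ] HTensor A R) e f, block_mem_traceClass X.2 e f⟩ :
      traceClass A)

/-- The trace norm `‖(Φ ⊗ Id_R)(X)‖₁` in `[0, ∞]`; it is `∞` when `(Φ ⊗ Id_R)(X)` is not a bounded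
operator. -/
def tensorIdTraceNorm (Φ : traceClass A →ₗ[ℂ] traceClass A)
    (X : traceClass (HTensor A R)) : ℝ≥0∞ :=
  ⨅ (Y : HTensor A R →L[ℂ] HTensor A R) (_ : IsTensorIdImage Φ X Y), traceNorm Y

/-- Linear maps on trace-class operators that preserve Hermiticity. -/
def IsHermitianPreserving (Φ : traceClass A →ₗ[ℂ] traceClass A) : Prop :=
  ∀ T : traceClass A, IsSelfAdjoint (T : A →L[ℂ] A) → IsSelfAdjoint (Φ T : A →L[ℂ] A)

/-- The energy-constrained diamond norm, in `[0, ∞]`: the supremum of `‖(Φ ⊗ Id_R)(ρ)‖₁` over the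
density operators `ρ` on `A ⊗ R`, with `R` a copy of `A`, whose marginal on `A` has mean photon
number at most `E`. -/
def ecDiamondNorm (fock : HilbertBasis ℕ ℂ A) (E : ℝ) (Φ : traceClass A →ₗ[ℂ] traceClass A) :
    ℝ≥0∞ :=
  ⨆ (ρ : traceClass (HTensor A A)) (_ : IsDensity (ρ : HTensor A A →L[ℂ] HTensor A A))
    (_ : partialTrace fock (ρ : HTensor A A →L[ℂ] HTensor A A) ∈ energyStates fock E),
    tensorIdTraceNorm Φ ρ

end Blocks

end

/-! Cut the energy at `E / ε ^ 2`: let `P` be the spectral projection onto levels below the cutoff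
and `Q = 1 - P`. By Markov's inequality a state of energy `E` has weight at most `ε ^ 2` above it.
The Jordan decomposition gives `ρ - σ = X - X'` with positive parts of trace at most `ε` each
(`exists_sub_eq_sub_posTrace_le`), but these parts need not have controlled energy. Hence they are
used only inside the cutoff, as `P * X * P`, and the rest of `ρ - σ` is taken from the states
themselves.

The rest contains the off-diagonal blocks `P * ρ * Q`, which are neither positive nor of trace norm
clearly of order `ε` as differences of positive operators. Conjugation by `K = √ε • P + (√ε)⁻¹ • Q`
leaves these blocks unchanged, and `K * ρ * K` is positive of trace at most `2 * ε`. Correcting the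
diagonal blocks (`conj_sub_conj_eq`) writes `ρ - σ = Y - Y'` with `Y`, `Y'` positive, of trace at
most `5 * ε` and energy at most `5 * ε * (E / ε ^ 2)` (`cutoff_bounds`).

Finally, the diamond norm controls every such positive operator by scaling
(`tensorIdTraceNorm_le_ecDiamondNorm`): the reference system is embedded into a copy of `A`, and
missing trace is supplied by a zero-energy pure state that the embedded system cannot see. The
triangle inequality then gives `5 + 5 = 10`. -/

section TraceNorm

/-! ### Traces of positive operators, polar decomposition and trace-norm duality. -/

variable {H G : Type*} [NormedAddCommGroup H] [InnerProductSpace ℂ H]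
  [NormedAddCommGroup G] [InnerProductSpace ℂ G]

theorem enorm_sq_eq_ofReal {E : Type*} [SeminormedAddCommGroup E] (x : E) :
    ‖x‖ₑ ^ 2 = ENNReal.ofReal (‖x‖ ^ 2) := by
  rw [ENNReal.ofReal_pow (norm_nonneg x), ofReal_norm]

/-- The Parseval identity with values in `[0, ∞]`. -/
theorem HilbertBasis.tsum_enorm_inner_sq {ι : Type*} (e : HilbertBasis ι ℂ H) (x : H) :
    ∑' i, ‖⟪e i, x⟫_ℂ‖ₑ ^ 2 = ‖x‖ₑ ^ 2 := by
  have h := e.hasSum_inner_mul_inner x x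
  have hsum : HasSum (fun i => ‖⟪e i, x⟫_ℂ‖ ^ 2) (‖x‖ ^ 2) := by
    have := Complex.hasSum_re h
    have hx : (⟪x, x⟫_ℂ).re = ‖x‖ ^ 2 := inner_self_eq_norm_sq (𝕜 := ℂ) x
    rw [hx] at this
    convert! this using 2 with i
    rw [← inner_conj_symm x (e i), Complex.conj_mul']
    norm_cast
  simp_rw [enorm_sq_eq_ofReal]
  rw [← ENNReal.ofReal_tsum_of_nonneg (fun i => by positivity) hsum.summable, hsum.tsum_eq]

/-- The Bessel inequality with values in `[0, ∞]`. -/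
theorem sum_enorm_inner_sq_le {s : Finset H} (hs : Orthonormal ℂ ((↑) : s → H)) (y : H) :
    ∑ x ∈ s, ‖⟪y, x⟫_ℂ‖ₑ ^ 2 ≤ ‖y‖ₑ ^ 2 := by
  have h := hs.sum_inner_products_le (x := y) (s := Finset.univ)
  rw [Finset.univ_eq_attach, Finset.sum_attach s (fun x => ‖⟪x, y⟫_ℂ‖ ^ 2)] at h
  simp_rw [enorm_sq_eq_ofReal]
  rw [← ENNReal.ofReal_sum_of_nonneg (fun i _ => by positivity)]
  refine ENNReal.ofReal_le_ofReal (le_trans (le_of_eq ?_) h)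
  exact Finset.sum_congr rfl fun x _ => by rw [norm_inner_symm]

theorem le_posTrace (T : H →L[ℂ] H) {s : Finset H} (hs : Orthonormal ℂ ((↑) : s → H)) :
    ∑ x ∈ s, ENNReal.ofReal (⟪x, T x⟫_ℂ).re ≤ posTrace T :=
  le_iSup₂_of_le s hs le_rfl

theorem HilbertBasis.orthonormal_image {ι : Type*} [DecidableEq H] (e : HilbertBasis ι ℂ H)
    (t : Finset ι) : Orthonormal ℂ ((↑) : (Finset.image e t) → H) := by
  classical
  rw [orthonormal_subtype_iff_ite]
  intro v hv w hw
  obtain ⟨i, -, rfl⟩ := Finset.mem_image.mp hv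
  obtain ⟨j, -, rfl⟩ := Finset.mem_image.mp hw
  rw [orthonormal_iff_ite.mp e.orthonormal i j]
  simp [e.orthonormal.linearIndependent.injective.eq_iff]

theorem ContinuousLinearMap.IsPositive.re_inner_apply_nonneg {T : H →L[ℂ] H} (hT : T.IsPositive)
    (x : H) : 0 ≤ (⟪x, T x⟫_ℂ).re :=
  hT.re_inner_nonneg_right x

theorem posTrace_smul {c : ℝ} (hc : 0 ≤ c) (T : H →L[ℂ] H) :
    posTrace ((c : ℂ) • T) = ENNReal.ofReal c * posTrace T := by
  simp_rw [posTrace, ENNReal.mul_iSup, Finset.mul_sum]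
  refine iSup_congr fun s => iSup_congr fun _ => Finset.sum_congr rfl fun x _ => ?_
  rw [← ENNReal.ofReal_mul hc, smul_apply, inner_smul_right,
    Complex.re_ofReal_mul]

variable [CompleteSpace H] [CompleteSpace G]

/-- A Hilbert–Schmidt sum over an orthonormal family is bounded by the Hilbert–Schmidt sum of the
adjoint over a Hilbert basis. -/
theorem sum_enorm_sq_le_tsum_adjoint {ι : Type*} (e : HilbertBasis ι ℂ G) (S : H →L[ℂ] G)
    {s : Finset H} (hs : Orthonormal ℂ ((↑) : s → H)) :
    ∑ x ∈ s, ‖S x‖ₑ ^ 2 ≤ ∑' i, ‖ContinuousLinearMap.adjoint S (e i)‖ₑ ^ 2 := by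
  -- Expand each `S x` by Parseval, exchange the sums, and apply Bessel to the adjoint at each basis
  -- vector.
  simp_rw [← e.tsum_enorm_inner_sq (S _)]
  rw [← Summable.tsum_finsetSum (fun _ _ => ENNReal.summable)]
  refine ENNReal.tsum_le_tsum fun i => ?_
  simp_rw [← ContinuousLinearMap.adjoint_inner_left]
  exact sum_enorm_inner_sq_le hs _

theorem ContinuousLinearMap.IsPositive.ofReal_re_inner {T : H →L[ℂ] H} (hT : T.IsPositive)
    (x : H) : ENNReal.ofReal (⟪x, T x⟫_ℂ).re = ‖CFC.sqrt T x‖ₑ ^ 2 := by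
  have h0 : 0 ≤ T := (ContinuousLinearMap.nonneg_iff_isPositive T).mpr hT
  have hS := (ContinuousLinearMap.nonneg_iff_isPositive _).mp (CFC.sqrt_nonneg T)
  rw [enorm_sq_eq_ofReal]
  congr 1
  have h1 : T x = CFC.sqrt T (CFC.sqrt T x) := by
    conv_lhs => rw [← CFC.sqrt_mul_sqrt_self T h0]
    rfl
  rw [h1, ← hS.inner_left_eq_inner_right]
  exact inner_self_eq_norm_sq (𝕜 := ℂ) _

/-- Passing to adjoints turns `√T W` into `W† √T`, where the contraction acts last and can be
dropped. The family `W x` itself need not be orthonormal. -/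
theorem ContinuousLinearMap.IsPositive.sum_enorm_sqrt_comp_sq_le {ι : Type*}
    (e : HilbertBasis ι ℂ H) {T : H →L[ℂ] H} (hT : T.IsPositive) {W : G →L[ℂ] H} (hW : ‖W‖ ≤ 1)
    {s : Finset G} (hs : Orthonormal ℂ ((↑) : s → G)) :
    ∑ x ∈ s, ‖CFC.sqrt T (W x)‖ₑ ^ 2 ≤ ∑' i, ENNReal.ofReal (⟪e i, T (e i)⟫_ℂ).re := by
  have hS := (ContinuousLinearMap.nonneg_iff_isPositive _).mp (CFC.sqrt_nonneg T)
  refine (sum_enorm_sq_le_tsum_adjoint e ((CFC.sqrt T).comp W) hs).trans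
    (ENNReal.tsum_le_tsum fun i => ?_)
  rw [hT.ofReal_re_inner, ContinuousLinearMap.adjoint_comp, hS.isSelfAdjoint.adjoint_eq,
    enorm_sq_eq_ofReal, enorm_sq_eq_ofReal]
  refine ENNReal.ofReal_le_ofReal (pow_le_pow_left₀ (norm_nonneg _) ?_ 2)
  refine (ContinuousLinearMap.le_opNorm (ContinuousLinearMap.adjoint W) _).trans
    (mul_le_of_le_one_left (norm_nonneg _) ?_)
  rwa [LinearIsometryEquiv.norm_map]

/-- The trace of a positive operator can be computed in any Hilbert basis. -/
theorem ContinuousLinearMap.IsPositive.posTrace_eq_tsum {ι : Type*}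
    (e : HilbertBasis ι ℂ H) {T : H →L[ℂ] H} (hT : T.IsPositive) :
    posTrace T = ∑' i, ENNReal.ofReal (⟪e i, T (e i)⟫_ℂ).re := by
  classical
  refine le_antisymm (iSup₂_le fun s hs => ?_) ?_
  · simp_rw [hT.ofReal_re_inner]
    simpa [hT.ofReal_re_inner] using hT.sum_enorm_sqrt_comp_sq_le e
      (W := ContinuousLinearMap.id ℂ H) ContinuousLinearMap.norm_id_le hs
  · rw [ENNReal.tsum_eq_iSup_sum]
    refine iSup_le fun t => ?_
    refine le_trans (le_of_eq ?_) (le_posTrace T (e.orthonormal_image t))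
    rw [Finset.sum_image fun a _ b _ h => e.orthonormal.linearIndependent.injective h]

theorem ContinuousLinearMap.IsPositive.sum_enorm_sqrt_comp_sq_le_posTrace
    {T : H →L[ℂ] H} (hT : T.IsPositive) {W : G →L[ℂ] H} (hW : ‖W‖ ≤ 1)
    {s : Finset G} (hs : Orthonormal ℂ ((↑) : s → G)) :
    ∑ x ∈ s, ‖CFC.sqrt T (W x)‖ₑ ^ 2 ≤ posTrace T := by
  obtain ⟨w, e, -⟩ := exists_hilbertBasis ℂ H
  exact (hT.sum_enorm_sqrt_comp_sq_le e hW hs).trans (hT.posTrace_eq_tsum e).ge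

theorem posTrace_add {S T : H →L[ℂ] H} (hS : S.IsPositive) (hT : T.IsPositive) :
    posTrace (S + T) = posTrace S + posTrace T := by
  obtain ⟨w, e, -⟩ := exists_hilbertBasis ℂ H
  rw [(hS.add hT).posTrace_eq_tsum e, hS.posTrace_eq_tsum e, hT.posTrace_eq_tsum e,
    ← ENNReal.tsum_add]
  refine tsum_congr fun i => ?_
  rw [← ENNReal.ofReal_add (hS.re_inner_apply_nonneg _) (hT.re_inner_apply_nonneg _)]
  simp

/-- A single unit vector is already an orthonormal family, so the trace bounds `‖√T u‖ ^ 2`. This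
gives the operator-norm convergence of partial traces. -/
theorem norm_le_posTrace {T : H →L[ℂ] H} (hT : T.IsPositive) (hfin : posTrace T ≠ ∞) :
    ‖T‖ ≤ (posTrace T).toReal := by
  classical
  have hS := (ContinuousLinearMap.nonneg_iff_isPositive _).mp (CFC.sqrt_nonneg T)
  have h0 : 0 ≤ T := (ContinuousLinearMap.nonneg_iff_isPositive T).mpr hT
  have hle : ∀ x : H, ‖CFC.sqrt T x‖ ≤ √(posTrace T).toReal * ‖x‖ := by
    intro x
    by_cases hx : x = 0
    · simp [hx]
    have hn : ‖x‖ ≠ 0 := norm_ne_zero_iff.mpr hx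
    set u : H := ((‖x‖⁻¹ : ℝ) : ℂ) • x with hu
    have hu1 : ‖u‖ = 1 := by simp [hu, norm_smul, hn]
    have hs : Orthonormal ℂ ((↑) : ({u} : Finset H) → H) := by
      rw [orthonormal_subtype_iff_ite]
      simp [inner_self_eq_norm_sq_to_K, hu1]
    have h := le_posTrace T hs
    rw [Finset.sum_singleton, hT.ofReal_re_inner, enorm_sq_eq_ofReal,
      ENNReal.ofReal_le_iff_le_toReal hfin] at h
    have h2 : ‖CFC.sqrt T u‖ ≤ √(posTrace T).toReal := Real.le_sqrt_of_sq_le h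
    rw [hu, map_smul, norm_smul] at h2
    simp only [Complex.norm_real, norm_inv, norm_norm] at h2
    rwa [inv_mul_le_iff₀ (by positivity), mul_comm] at h2
  have hn : ‖CFC.sqrt T‖ ≤ √(posTrace T).toReal :=
    ContinuousLinearMap.opNorm_le_bound _ (Real.sqrt_nonneg _) hle
  calc ‖T‖ = ‖CFC.sqrt T * CFC.sqrt T‖ := by rw [CFC.sqrt_mul_sqrt_self T h0]
    _ ≤ ‖CFC.sqrt T‖ * ‖CFC.sqrt T‖ := norm_mul_le _ _
    _ ≤ √(posTrace T).toReal * √(posTrace T).toReal := by gcongr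
    _ = _ := Real.mul_self_sqrt ENNReal.toReal_nonneg

/-- Polar decomposition of a bounded operator. -/
theorem exists_polar_decomposition (T : H →L[ℂ] H) :
    ∃ U : H →L[ℂ] H, ‖U‖ ≤ 1 ∧ U * CFC.abs T = T ∧ star U * T = CFC.abs T := by
  set a := CFC.abs T with ha
  have hpos : a.IsPositive :=
    (ContinuousLinearMap.nonneg_iff_isPositive _).mp (CFC.abs_nonneg T)
  have hin : ∀ x y : H, ⟪a x, a y⟫_ℂ = ⟪T x, T y⟫_ℂ := by
    intro x y
    rw [hpos.inner_left_eq_inner_right, ← ContinuousLinearMap.adjoint_inner_right]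
    change ⟪x, (a * a) y⟫_ℂ = ⟪x, (star T * T) y⟫_ℂ
    rw [CFC.abs_mul_abs]
  have hnorm : ∀ x : H, ‖T x‖ = ‖a x‖ := by
    intro x
    rw [@norm_eq_sqrt_re_inner ℂ, @norm_eq_sqrt_re_inner ℂ _ _ _ _ (a x), hin]
  -- Since `‖T x‖ = ‖|T| x‖`, the map `|T| x ↦ T x` is well defined and isometric on the range of
  -- `|T|`; it extends to the closure `K` and is set to zero on `Kᗮ`.
  set K : Submodule ℂ H := (LinearMap.range a.toLinearMap).topologicalClosure with hK
  have hKc : IsClosed (K : Set H) := Submodule.isClosed_topologicalClosure _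
  have : CompleteSpace K := hKc.completeSpace_coe
  let e : H →ₗ[ℂ] K := a.toLinearMap.codRestrict K fun x =>
    Submodule.le_topologicalClosure _ ⟨x, rfl⟩
  have he : DenseRange e := by
    intro z
    rw [closure_subtype]
    have hz : (z : H) ∈ closure (Set.range a) := z.2
    convert hz using 2
    ext y
    simp [e]
  let V : K →L[ℂ] H := T.toLinearMap.extendOfNorm e
  have hVnorm : ∀ x : H, ‖T.toLinearMap x‖ ≤ 1 * ‖e x‖ := by
    intro x
    simpa [e] using (hnorm x).le
  have hV : ∀ x, V (e x) = T x := LinearMap.extendOfNorm_eq he ⟨1, hVnorm⟩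
  have hV1 : ‖V‖ ≤ 1 := LinearMap.opNorm_extendOfNorm_le he zero_le_one hVnorm
  refine ⟨V.comp K.orthogonalProjectionOnto, ?_, ?_, ?_⟩
  · refine (ContinuousLinearMap.opNorm_comp_le _ _).trans ?_
    exact mul_le_one₀ hV1 (norm_nonneg _) K.orthogonalProjectionOnto_norm_le
  · ext x
    have : K.orthogonalProjectionOnto (a x) = e x :=
      K.orthogonalProjectionOnto_mem_subspace_eq_self (e x)
    simp [this, hV]
  · set U := V.comp K.orthogonalProjectionOnto with hU
    have hUa : ∀ x, U (a x) = T x := by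
      intro x
      have : K.orthogonalProjectionOnto (a x) = e x :=
        K.orthogonalProjectionOnto_mem_subspace_eq_self (e x)
      simp [hU, this, hV]
    ext x
    -- For `U† T = |T|`, the difference of the two sides at `x` is shown to lie in both `K` and
    -- `Kᗮ`.
    have hmem : ∀ w, star U w ∈ K := by
      intro w
      rw [← K.orthogonal_orthogonal, Submodule.mem_orthogonal]
      intro z hz
      change ⟪z, ContinuousLinearMap.adjoint U w⟫_ℂ = 0
      rw [ContinuousLinearMap.adjoint_inner_right, hU]
      simp [K.orthogonalProjectionOnto_eq_zero_iff.mpr hz]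
    have hd : (star U * T) x - a x ∈ K := K.sub_mem (hmem _) (e x).2
    have hd_orth : (star U * T) x - a x ∈ Kᗮ := by
      rw [hK, Submodule.orthogonal_closure, Submodule.mem_orthogonal]
      rintro _ ⟨y, rfl⟩
      change ⟪a y, ContinuousLinearMap.adjoint U (T x) - a x⟫_ℂ = 0
      rw [inner_sub_right, ContinuousLinearMap.adjoint_inner_right, hUa, hin, sub_self]
    exact sub_eq_zero.mp (Submodule.disjoint_def.mp K.orthogonal_disjoint _ hd hd_orth)

/-- Duality between the trace norm and the operator norm. -/
theorem ofReal_sum_re_inner_le_traceNorm (T : H →L[ℂ] H) {U : H →L[ℂ] H} (hU : ‖U‖ ≤ 1)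
    {s : Finset H} (hs : Orthonormal ℂ ((↑) : s → H)) :
    ENNReal.ofReal (∑ x ∈ s, (⟪U x, T x⟫_ℂ).re) ≤ traceNorm T := by
  obtain ⟨V, hV, hVT, -⟩ := exists_polar_decomposition T
  set a := CFC.abs T with ha
  have hpos : a.IsPositive :=
    (ContinuousLinearMap.nonneg_iff_isPositive _).mp (CFC.abs_nonneg T)
  have hS := (ContinuousLinearMap.nonneg_iff_isPositive _).mp (CFC.sqrt_nonneg a)
  have hW : ‖star V * U‖ ≤ 1 := (norm_mul_le _ _).trans
    (mul_le_one₀ (by rwa [norm_star]) (norm_nonneg _) hU)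
  -- With `T = V |T|`, half of `|T|` is moved to each side of the inner product; then Cauchy–Schwarz
  -- and `2 * x * y ≤ x ^ 2 + y ^ 2` leave two sums, each at most the trace of `|T|`.
  have key : ∀ x : H, (⟪U x, T x⟫_ℂ).re ≤
      2⁻¹ * (‖CFC.sqrt a ((star V * U) x)‖ ^ 2 + ‖CFC.sqrt a x‖ ^ 2) := by
    intro x
    have h1 : ⟪U x, T x⟫_ℂ = ⟪CFC.sqrt a ((star V * U) x), CFC.sqrt a x⟫_ℂ := by
      rw [hS.inner_left_eq_inner_right]
      change _ = ⟪ContinuousLinearMap.adjoint V (U x), (CFC.sqrt a * CFC.sqrt a) x⟫_ℂ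
      rw [CFC.sqrt_mul_sqrt_self a (CFC.abs_nonneg T), ContinuousLinearMap.adjoint_inner_left]
      conv_lhs => rw [← hVT]
      rfl
    rw [h1]
    have h2 := re_inner_le_norm (𝕜 := ℂ) (CFC.sqrt a ((star V * U) x)) (CFC.sqrt a x)
    have h3 := two_mul_le_add_sq ‖CFC.sqrt a ((star V * U) x)‖ ‖CFC.sqrt a x‖
    simp only [RCLike.re_to_complex] at h2
    linarith
  calc ENNReal.ofReal (∑ x ∈ s, (⟪U x, T x⟫_ℂ).re)
      ≤ ENNReal.ofReal (∑ x ∈ s,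
          2⁻¹ * (‖CFC.sqrt a ((star V * U) x)‖ ^ 2 + ‖CFC.sqrt a x‖ ^ 2)) :=
        ENNReal.ofReal_le_ofReal (Finset.sum_le_sum fun x _ => key x)
    _ = 2⁻¹ * (∑ x ∈ s, ‖CFC.sqrt a ((star V * U) x)‖ₑ ^ 2
          + ∑ x ∈ s, ‖CFC.sqrt a (ContinuousLinearMap.id ℂ H x)‖ₑ ^ 2) := by
        rw [← Finset.mul_sum, ENNReal.ofReal_mul (by norm_num), Finset.sum_add_distrib,
          ENNReal.ofReal_add (by positivity) (by positivity),
          ENNReal.ofReal_sum_of_nonneg (fun _ _ => by positivity),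
          ENNReal.ofReal_sum_of_nonneg (fun _ _ => by positivity),
          ENNReal.ofReal_inv_of_pos (by norm_num)]
        simp only [enorm_sq_eq_ofReal, ContinuousLinearMap.id_apply, ENNReal.ofReal_ofNat]
    _ ≤ 2⁻¹ * (posTrace a + posTrace a) := by
        exact mul_le_mul_right (add_le_add (hpos.sum_enorm_sqrt_comp_sq_le_posTrace hW hs)
          (hpos.sum_enorm_sqrt_comp_sq_le_posTrace ContinuousLinearMap.norm_id_le hs)) _
    _ = traceNorm T := by
        rw [← two_mul, ← mul_assoc, ENNReal.inv_mul_cancel (by simp) (by simp), one_mul]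
        rfl

/-- The polar factor of `T` attains the duality: it turns the tested sums into those defining the
trace of `|T|`. Trace-norm inequalities thus reduce to finite sums linear in `T`. -/
theorem traceNorm_le_of_forall {T : H →L[ℂ] H} {C : ℝ≥0∞}
    (h : ∀ U : H →L[ℂ] H, ‖U‖ ≤ 1 → ∀ s : Finset H, Orthonormal ℂ ((↑) : s → H) →
      ENNReal.ofReal (∑ x ∈ s, (⟪U x, T x⟫_ℂ).re) ≤ C) : traceNorm T ≤ C := by
  obtain ⟨U, hU, -, hUT⟩ := exists_polar_decomposition T
  refine iSup₂_le fun s hs => le_trans (le_of_eq ?_) (h U hU s hs)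
  have hpos : (CFC.abs T).IsPositive :=
    (ContinuousLinearMap.nonneg_iff_isPositive _).mp (CFC.abs_nonneg T)
  change ∑ x ∈ s, ENNReal.ofReal (⟪x, CFC.abs T x⟫_ℂ).re = _
  rw [← ENNReal.ofReal_sum_of_nonneg fun x _ => hpos.re_inner_apply_nonneg x, ← hUT]
  congr 1
  refine Finset.sum_congr rfl fun x _ => ?_
  change (⟪x, ContinuousLinearMap.adjoint U (T x)⟫_ℂ).re = _
  rw [ContinuousLinearMap.adjoint_inner_right]

theorem traceNorm_sub_le (S T : H →L[ℂ] H) :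
    traceNorm (S - T) ≤ traceNorm S + traceNorm T := by
  refine traceNorm_le_of_forall fun U hU s hs => ?_
  have h1 := ofReal_sum_re_inner_le_traceNorm S hU hs
  have h2 := ofReal_sum_re_inner_le_traceNorm T (U := -U) (by rwa [norm_neg]) hs
  refine le_trans (le_of_eq ?_) ((ENNReal.ofReal_add_le).trans (add_le_add h1 h2))
  rw [← Finset.sum_add_distrib]
  congr 1
  refine Finset.sum_congr rfl fun x _ => ?_
  simp [inner_neg_left, sub_eq_add_neg]

theorem traceNorm_smul {c : ℝ} (hc : 0 ≤ c) (T : H →L[ℂ] H) :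
    traceNorm ((c : ℂ) • T) = ENNReal.ofReal c * traceNorm T := by
  have h : CFC.abs ((c : ℂ) • T) = (c : ℂ) • CFC.abs T := by
    rw [CFC.abs_smul, Complex.norm_real, Real.norm_of_nonneg hc, Complex.coe_smul]
  change posTrace (CFC.abs ((c : ℂ) • T)) = _
  rw [h, posTrace_smul hc]
  rfl

/-- Compression by an isometry does not increase the trace norm. -/
theorem traceNorm_isometry_compression_le (W : H →ₗᵢ[ℂ] G) (Z : G →L[ℂ] G) :
    traceNorm ((ContinuousLinearMap.adjoint W.toContinuousLinearMap).comp
      (Z.comp W.toContinuousLinearMap)) ≤ traceNorm Z := by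
  classical
  refine traceNorm_le_of_forall fun U hU s hs => ?_
  set W' := W.toContinuousLinearMap with hW'
  have hWn : ‖W'‖ ≤ 1 := W.norm_toContinuousLinearMap_le
  have hWW : ∀ x, ContinuousLinearMap.adjoint W' (W x) = x := fun x =>
    ext_inner_left ℂ fun v => by
      rw [ContinuousLinearMap.adjoint_inner_right]
      exact W.inner_map_map v x
  have ht : Orthonormal ℂ ((↑) : (s.image W) → G) := by
    rw [orthonormal_subtype_iff_ite]
    intro v hv w hw
    obtain ⟨a, ha, rfl⟩ := Finset.mem_image.mp hv
    obtain ⟨b, hb, rfl⟩ := Finset.mem_image.mp hw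
    rw [W.inner_map_map, (orthonormal_subtype_iff_ite.mp hs) a ha b hb]
    simp [W.injective.eq_iff]
  -- A test pair `U`, `s` for the compression becomes the test pair `W U W†`, `W '' s` for `Z`, with
  -- the same value.
  have hn : ‖W'.comp (U.comp (ContinuousLinearMap.adjoint W'))‖ ≤ 1 := by
    refine (ContinuousLinearMap.opNorm_comp_le _ _).trans (mul_le_one₀ hWn (norm_nonneg _) ?_)
    refine (ContinuousLinearMap.opNorm_comp_le _ _).trans (mul_le_one₀ hU (norm_nonneg _) ?_)
    rwa [LinearIsometryEquiv.norm_map]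
  refine le_trans (le_of_eq ?_) (ofReal_sum_re_inner_le_traceNorm Z hn ht)
  rw [Finset.sum_image fun a _ b _ h => W.injective h]
  congr 1
  refine Finset.sum_congr rfl fun x _ => ?_
  simp [hWW, ContinuousLinearMap.adjoint_inner_right]
  rfl

end TraceNorm

/-! ### Product bases and isometries of Hilbert-space tensor products. -/

section TensorBasis

variable {A R S : Type*} [NormedAddCommGroup A] [InnerProductSpace ℂ A]
  [NormedAddCommGroup R] [InnerProductSpace ℂ R] [NormedAddCommGroup S] [InnerProductSpace ℂ S]

theorem HilbertBasis.clm_ext {ι H F : Type*} [NormedAddCommGroup H] [InnerProductSpace ℂ H]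
    [NormedAddCommGroup F] [NormedSpace ℂ F] (e : HilbertBasis ι ℂ H) {f g : H →L[ℂ] F}
    (h : ∀ i, f (e i) = g (e i)) : f = g := by
  refine ContinuousLinearMap.ext_on (s := Set.range e) ?_ ?_
  · rw [Submodule.dense_iff_topologicalClosure_eq_top]
    exact e.dense_span
  · rintro _ ⟨i, rfl⟩
    exact h i

theorem HTensor.clm_ext {F : Type*} [NormedAddCommGroup F] [NormedSpace ℂ F]
    {f g : HTensor A R →L[ℂ] F} (h : ∀ r a, f (tensorKet A r a) = g (tensorKet A r a)) :
    f = g := by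
  ext v
  induction v using UniformSpace.Completion.induction_on with
  | hp => exact isClosed_eq f.continuous g.continuous
  | ih t =>
    induction t using TensorProduct.induction_on with
    | zero => rw [UniformSpace.Completion.coe_zero, map_zero, map_zero]
    | tmul a r => exact h r a
    | add x y hx hy => rw [UniformSpace.Completion.coe_add, map_add, map_add, hx, hy]

theorem HTensor.eq_of_inner_tensorKet {v w : HTensor A R}
    (h : ∀ r a, ⟪v, tensorKet A r a⟫_ℂ = ⟪w, tensorKet A r a⟫_ℂ) : v = w :=
  ext_inner_right ℂ fun x =>
    congrArg (fun f : HTensor A R →L[ℂ] ℂ => f x) (HTensor.clm_ext (f := innerSL ℂ v)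
      (g := innerSL ℂ w) h)

theorem orthonormal_tensorKet {κ ι : Type*} (e : HilbertBasis κ ℂ A) (b : HilbertBasis ι ℂ R) :
    Orthonormal ℂ fun p : κ × ι => tensorKet A (b p.2) (e p.1) := by
  classical
  rw [orthonormal_iff_ite]
  rintro ⟨n, i⟩ ⟨m, j⟩
  rw [inner_tensorKet, orthonormal_iff_ite.mp e.orthonormal, orthonormal_iff_ite.mp b.orthonormal]
  by_cases h1 : n = m <;> by_cases h2 : i = j <;> simp [h1, h2]

/-- The product Hilbert basis of a Hilbert-space tensor product. -/
noncomputable def tensorBasis {κ ι : Type*} (e : HilbertBasis κ ℂ A) (b : HilbertBasis ι ℂ R) :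
    HilbertBasis (κ × ι) ℂ (HTensor A R) :=
  HilbertBasis.mkOfOrthogonalEqBot (orthonormal_tensorKet e b) <| by
    rw [Submodule.eq_bot_iff]
    intro v hv
    have h0 : ∀ n i, ⟪v, tensorKet A (b i) (e n)⟫_ℂ = 0 := fun n i =>
      Submodule.inner_left_of_mem_orthogonal (Submodule.subset_span (Set.mem_range_self (n, i))) hv
    have h1 : ∀ i a, ⟪v, tensorKet A (b i) a⟫_ℂ = 0 := fun i a => by
      have : (innerSL ℂ v).comp (tensorKet A (b i)) = 0 := e.clm_ext fun n => h0 n i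
      exact congrArg (fun f : A →L[ℂ] ℂ => f a) this
    refine HTensor.eq_of_inner_tensorKet fun r a => ?_
    have : (innerSL ℂ v).comp
        (UniformSpace.Completion.toComplL.comp (TensorProduct.mkL ℂ A R a)) = 0 :=
      b.clm_ext fun i => h1 i a
    rw [inner_zero_left]
    exact congrArg (fun f : R →L[ℂ] ℂ => f r) this

theorem tensorBasis_apply {κ ι : Type*} (e : HilbertBasis κ ℂ A) (b : HilbertBasis ι ℂ R)
    (p : κ × ι) : tensorBasis e b p = tensorKet A (b p.2) (e p.1) := by
  rw [tensorBasis, HilbertBasis.coe_mkOfOrthogonalEqBot]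

/-- The isometry `I ⊗ V` between Hilbert-space tensor products. -/
theorem exists_isometry_tensorKet (A : Type*) [NormedAddCommGroup A] [InnerProductSpace ℂ A]
    (V : R →ₗᵢ[ℂ] S) : ∃ W : HTensor A R →ₗᵢ[ℂ] HTensor A S,
      ∀ r a, W (tensorKet A r a) = tensorKet A (V r) a := by
  let f : A ⊗[ℂ] R →L[ℂ] HTensor A S :=
    UniformSpace.Completion.toComplL.comp (V.lTensor A).toContinuousLinearMap
  let i : A ⊗[ℂ] R →L[ℂ] HTensor A R := UniformSpace.Completion.toComplL
  have hi : DenseRange i := UniformSpace.Completion.denseRange_coe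
  have hu : IsUniformInducing i := UniformSpace.Completion.isUniformInducing_coe _
  have hf : ∀ x : A ⊗[ℂ] R, f.extend i (x : HTensor A R) = f x := fun x => f.extend_eq hi hu x
  refine ⟨⟨(f.extend i).toLinearMap, fun v => ?_⟩, fun r a => ?_⟩
  · induction v using UniformSpace.Completion.induction_on with
    | hp => exact isClosed_eq (f.extend i).continuous.norm continuous_norm
    | ih t =>
      change ‖f.extend i (t : HTensor A R)‖ = _
      rw [hf, UniformSpace.Completion.norm_coe]
      change ‖((V.lTensor A t : A ⊗[ℂ] S) : HTensor A S)‖ = _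
      rw [UniformSpace.Completion.norm_coe, LinearIsometry.norm_map]
  · change f.extend i ((a ⊗ₜ[ℂ] r : A ⊗[ℂ] R) : HTensor A R) = _
    rw [hf]
    rfl

/-- A separable Hilbert space embeds isometrically along an injection of index sets. -/
theorem HilbertBasis.exists_isometry {ι κ : Type*} [CompleteSpace A] (e : HilbertBasis κ ℂ A)
    (b : HilbertBasis ι ℂ R) {j : ι → κ} (hj : Function.Injective j) :
    ∃ V : R →ₗᵢ[ℂ] A, ∀ i, V (b i) = e (j i) := by
  classical
  have ho : Orthonormal ℂ (e ∘ j) := e.orthonormal.comp j hj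
  refine ⟨ho.orthogonalFamily.linearIsometry.comp b.repr.toLinearIsometry, fun i => ?_⟩
  simp [HilbertBasis.repr_self]

end TensorBasis

/-! ### Traces weighted by a function of the energy level. -/

section WeightedTrace

variable {A R : Type*} [NormedAddCommGroup A] [InnerProductSpace ℂ A]
  [NormedAddCommGroup R] [InnerProductSpace ℂ R] {κ ι : Type*}

/-- The trace `Tr ((∑ w(n) |n⟩⟨n| ⊗ I) Y)` of a positive operator `Y` on `A ⊗ R`. -/
noncomputable def weightedTrace (e : HilbertBasis κ ℂ A) (b : HilbertBasis ι ℂ R) (w : κ → ℝ≥0∞)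
    (Y : HTensor A R →L[ℂ] HTensor A R) : ℝ≥0∞ :=
  ∑' p : κ × ι, w p.1 *
    ENNReal.ofReal (⟪tensorKet A (b p.2) (e p.1), Y (tensorKet A (b p.2) (e p.1))⟫_ℂ).re

variable {e : HilbertBasis κ ℂ A} {b : HilbertBasis ι ℂ R}

theorem posTrace_eq_weightedTrace (e : HilbertBasis κ ℂ A) (b : HilbertBasis ι ℂ R)
    {Y : HTensor A R →L[ℂ] HTensor A R} (hY : Y.IsPositive) :
    posTrace Y = weightedTrace e b 1 Y := by
  rw [hY.posTrace_eq_tsum (tensorBasis e b), weightedTrace]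
  simp [tensorBasis_apply]

theorem weightedTrace_add (w : κ → ℝ≥0∞) {Y Z : HTensor A R →L[ℂ] HTensor A R}
    (hY : Y.IsPositive) (hZ : Z.IsPositive) :
    weightedTrace e b w (Y + Z) = weightedTrace e b w Y + weightedTrace e b w Z := by
  simp_rw [weightedTrace, ← ENNReal.tsum_add, ← mul_add]
  refine tsum_congr fun p => ?_
  rw [← ENNReal.ofReal_add (hY.re_inner_apply_nonneg _) (hZ.re_inner_apply_nonneg _)]
  simp [inner_add_right]

theorem weightedTrace_smul (w : κ → ℝ≥0∞) {c : ℝ} (hc : 0 ≤ c)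
    (Y : HTensor A R →L[ℂ] HTensor A R) :
    weightedTrace e b w ((c : ℂ) • Y) = ENNReal.ofReal c * weightedTrace e b w Y := by
  simp_rw [weightedTrace, ← ENNReal.tsum_mul_left]
  refine tsum_congr fun p => ?_
  rw [smul_apply, inner_smul_right, Complex.re_ofReal_mul, ENNReal.ofReal_mul hc]
  ring

theorem weightedTrace_mono {w w' : κ → ℝ≥0∞} (h : w ≤ w')
    (Y : HTensor A R →L[ℂ] HTensor A R) : weightedTrace e b w Y ≤ weightedTrace e b w' Y :=
  ENNReal.tsum_le_tsum fun p => by gcongr; exact h p.1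

theorem weightedTrace_weight_add (w w' : κ → ℝ≥0∞) (Y : HTensor A R →L[ℂ] HTensor A R) :
    weightedTrace e b (w + w') Y = weightedTrace e b w Y + weightedTrace e b w' Y := by
  simp_rw [weightedTrace, ← ENNReal.tsum_add, ← add_mul]
  rfl

theorem weightedTrace_weight_smul (c : ℝ≥0∞) (w : κ → ℝ≥0∞) (Y : HTensor A R →L[ℂ] HTensor A R) :
    weightedTrace e b (c • w) Y = c * weightedTrace e b w Y := by
  simp_rw [weightedTrace, ← ENNReal.tsum_mul_left, ← mul_assoc]
  rfl

/-- Conjugation by an operator that is diagonal in the first factor rescales the weights. -/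
theorem weightedTrace_conj_diagonal (w : κ → ℝ≥0∞) {D : HTensor A R →L[ℂ] HTensor A R}
    (hD : IsSelfAdjoint D) {k : κ → ℝ}
    (hk : ∀ n i, D (tensorKet A (b i) (e n)) = (k n : ℂ) • tensorKet A (b i) (e n))
    (Y : HTensor A R →L[ℂ] HTensor A R) :
    weightedTrace e b w (D * Y * D) =
      weightedTrace e b (fun n => w n * ENNReal.ofReal (k n ^ 2)) Y := by
  refine tsum_congr fun ⟨n, i⟩ => ?_
  rw [mul_assoc (w n), ← ENNReal.ofReal_mul (sq_nonneg _)]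
  congr 2
  have h1 : ∀ x y : HTensor A R, ⟪x, D y⟫_ℂ = ⟪D x, y⟫_ℂ := fun x y => by
    rw [← ContinuousLinearMap.adjoint_inner_right, hD.adjoint_eq]
  change (⟪_, D (Y (D _))⟫_ℂ).re = _
  rw [h1, hk, map_smul, inner_smul_left, inner_smul_right, Complex.conj_ofReal,
    Complex.re_ofReal_mul, Complex.re_ofReal_mul]
  ring

theorem weightedTrace_rankOne_tensorKet (w : κ → ℝ≥0∞) (n : κ) (i : ι) :
    weightedTrace e b w (InnerProductSpace.rankOne ℂ (tensorKet A (b i) (e n))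
      (tensorKet A (b i) (e n))) = w n := by
  classical
  have ho := orthonormal_iff_ite.mp (orthonormal_tensorKet e b)
  rw [weightedTrace, tsum_eq_single (n, i)]
  · rw [InnerProductSpace.rankOne_apply, inner_smul_right, ho (n, i) (n, i)]
    simp
  · intro p hp
    rw [InnerProductSpace.rankOne_apply, inner_smul_right, ho p (n, i), if_neg hp]
    simp

/-- Weighted traces are preserved by an isometry acting on the second factor that maps basis
vectors to basis vectors. -/
theorem weightedTrace_conj_isometry {S μ : Type*} [NormedAddCommGroup S] [InnerProductSpace ℂ S]
    [CompleteSpace R] (e : HilbertBasis κ ℂ A) (b : HilbertBasis ι ℂ R) (d : HilbertBasis μ ℂ S)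
    (w : κ → ℝ≥0∞) {j : ι → μ} (hj : Function.Injective j) {V : R →ₗᵢ[ℂ] S}
    (hV : ∀ i, V (b i) = d (j i)) {W : HTensor A R →ₗᵢ[ℂ] HTensor A S}
    (hW : ∀ r a, W (tensorKet A r a) = tensorKet A (V r) a)
    (Y : HTensor A R →L[ℂ] HTensor A R) :
    weightedTrace e d w (W.toContinuousLinearMap.comp
      (Y.comp (ContinuousLinearMap.adjoint W.toContinuousLinearMap))) =
      weightedTrace e b w Y := by
  classical
  set W' := W.toContinuousLinearMap with hW'
  have hWW : ∀ x, ContinuousLinearMap.adjoint W' (W x) = x := fun x =>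
    ext_inner_left ℂ fun v => by
      rw [ContinuousLinearMap.adjoint_inner_right]
      exact W.inner_map_map v x
  have hin : ∀ x : HTensor A S, ⟪x, W'.comp (Y.comp (ContinuousLinearMap.adjoint W')) x⟫_ℂ =
      ⟪ContinuousLinearMap.adjoint W' x, Y (ContinuousLinearMap.adjoint W' x)⟫_ℂ := fun x => by
    rw [ContinuousLinearMap.adjoint_inner_left]
    rfl
  -- Basis vectors outside the image of `j` are orthogonal to the range of `V`, so they contribute
  -- nothing and the sum over `μ` reduces to one over `ι`.
  have hker : ∀ m, m ∉ Set.range j → ∀ a,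
      ContinuousLinearMap.adjoint W' (tensorKet A (d m) a) = 0 := by
    intro m hm a
    have hVm : ∀ r, ⟪d m, V r⟫_ℂ = 0 := fun r => by
      have : (innerSL ℂ (d m)).comp V.toContinuousLinearMap = 0 := b.clm_ext fun i => by
        have hmi : m ≠ j i := fun h => hm ⟨i, h.symm⟩
        simp [hV, orthonormal_iff_ite.mp d.orthonormal, hmi]
      exact congrArg (fun f : R →L[ℂ] ℂ => f r) this
    refine HTensor.eq_of_inner_tensorKet fun r a' => ?_
    rw [ContinuousLinearMap.adjoint_inner_left, inner_zero_left]
    change ⟪_, W (tensorKet A r a')⟫_ℂ = 0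
    rw [hW, inner_tensorKet, hVm, mul_zero]
  have hinj : Function.Injective (fun p : κ × ι => (p.1, j p.2)) := fun p q h => by
    obtain ⟨h1, h2⟩ := Prod.mk.inj h
    exact Prod.ext h1 (hj h2)
  rw [weightedTrace, ← hinj.tsum_eq, weightedTrace]
  · refine tsum_congr fun p => ?_
    rw [hin, ← hV, ← hW, hWW]
  · intro p hp
    by_contra hnot
    refine hp ?_
    have : p.2 ∉ Set.range j := by
      rintro ⟨i, hi⟩
      exact hnot ⟨(p.1, i), by simp [hi]⟩
    simp [hker _ this]

end WeightedTrace

/-! ### Convergence, positivity, trace and energy of the partial trace. -/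

section PartialTrace

variable {A R : Type*} [NormedAddCommGroup A] [InnerProductSpace ℂ A] [CompleteSpace A]
  [NormedAddCommGroup R] [InnerProductSpace ℂ R] {κ ι : Type*}

/-- The traces of the diagonal blocks add up to the finite trace of `Y`, and for positive operators
the trace dominates the norm. -/
theorem summable_block (e : HilbertBasis κ ℂ A) (b : HilbertBasis ι ℂ R)
    {Y : HTensor A R →L[ℂ] HTensor A R} (hY : Y.IsPositive) (hfin : posTrace Y ≠ ∞) :
    Summable fun i => block Y (b i) (b i) := by
  have hsum : ∑' i, posTrace (block Y (b i) (b i)) = posTrace Y := by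
    simp_rw [fun i => (block_isPositive hY (b i)).posTrace_eq_tsum e, inner_block]
    rw [ENNReal.tsum_comm, hY.posTrace_eq_tsum (tensorBasis e b), ENNReal.tsum_prod']
    simp_rw [tensorBasis_apply]
  rw [← hsum] at hfin
  refine Summable.of_norm_bounded (ENNReal.summable_toReal hfin) fun i => ?_
  exact norm_le_posTrace (block_isPositive hY (b i)) (ENNReal.ne_top_of_tsum_ne_top hfin i)

theorem hasSum_inner_partialTrace (e : HilbertBasis κ ℂ A) (b : HilbertBasis ι ℂ R)
    {Y : HTensor A R →L[ℂ] HTensor A R} (hY : Y.IsPositive) (hfin : posTrace Y ≠ ∞) (a : A) :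
    HasSum (fun i => (⟪tensorKet A (b i) a, Y (tensorKet A (b i) a)⟫_ℂ).re)
      (⟪a, partialTrace b Y a⟫_ℂ).re := by
  have h1 := (summable_block e b hY hfin).hasSum
  have h2 := Complex.hasSum_re (((innerSL ℂ a).comp
    (ContinuousLinearMap.apply ℂ A a)).hasSum h1)
  simpa [Function.comp_def, inner_block] using! h2

theorem isPositive_partialTrace (e : HilbertBasis κ ℂ A) (b : HilbertBasis ι ℂ R)
    {Y : HTensor A R →L[ℂ] HTensor A R} (hY : Y.IsPositive) (hfin : posTrace Y ≠ ∞) :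
    (partialTrace b Y).IsPositive := by
  refine ContinuousLinearMap.isPositive_def'.mpr ⟨?_, fun a => ?_⟩
  · have h1 := (summable_block e b hY hfin).hasSum
    have h2 := h1.star
    simp_rw [fun i => (block_isPositive hY (b i)).isSelfAdjoint.star_eq] at h2
    exact h2.unique h1
  · rw [ContinuousLinearMap.reApplyInnerSelf_apply, inner_re_symm]
    exact (hasSum_inner_partialTrace e b hY hfin a).nonneg fun i => hY.re_inner_apply_nonneg _

theorem ofReal_inner_partialTrace (e : HilbertBasis κ ℂ A) (b : HilbertBasis ι ℂ R)
    {Y : HTensor A R →L[ℂ] HTensor A R} (hY : Y.IsPositive) (hfin : posTrace Y ≠ ∞) (a : A) :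
    ENNReal.ofReal (⟪a, partialTrace b Y a⟫_ℂ).re =
      ∑' i, ENNReal.ofReal (⟪tensorKet A (b i) a, Y (tensorKet A (b i) a)⟫_ℂ).re := by
  have h := hasSum_inner_partialTrace e b hY hfin a
  rw [← h.tsum_eq, ENNReal.ofReal_tsum_of_nonneg (fun i => hY.re_inner_apply_nonneg _) h.summable]

theorem posTrace_partialTrace (e : HilbertBasis κ ℂ A) (b : HilbertBasis ι ℂ R)
    {Y : HTensor A R →L[ℂ] HTensor A R} (hY : Y.IsPositive) (hfin : posTrace Y ≠ ∞) :
    posTrace (partialTrace b Y) = posTrace Y := by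
  rw [(isPositive_partialTrace e b hY hfin).posTrace_eq_tsum e,
    hY.posTrace_eq_tsum (tensorBasis e b), ENNReal.tsum_prod']
  simp_rw [ofReal_inner_partialTrace e b hY hfin, tensorBasis_apply]

theorem meanPhotonNumber_partialTrace (fock : HilbertBasis ℕ ℂ A) (b : HilbertBasis ι ℂ R)
    {Y : HTensor A R →L[ℂ] HTensor A R} (hY : Y.IsPositive) (hfin : posTrace Y ≠ ∞) :
    meanPhotonNumber fock (partialTrace b Y) = weightedTrace fock b (fun n => (n : ℝ≥0∞)) Y := by
  rw [weightedTrace, ENNReal.tsum_prod', meanPhotonNumber]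
  simp_rw [ofReal_inner_partialTrace fock b hY hfin, ENNReal.tsum_mul_left]

end PartialTrace

/-! ### Extensions `Φ ⊗ Id` and their control by the energy-constrained diamond norm. -/

section TensorIdImage

variable {A R : Type*} [NormedAddCommGroup A] [InnerProductSpace ℂ A] [CompleteSpace A]
  [NormedAddCommGroup R] [InnerProductSpace ℂ R]

theorem block_sub (X Y : HTensor A R →L[ℂ] HTensor A R) (e f : R) :
    block (X - Y) e f = block X e f - block Y e f := by
  ext; simp [block]

theorem block_smul (c : ℂ) (X : HTensor A R →L[ℂ] HTensor A R) (e f : R) :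
    block (c • X) e f = c • block X e f := by
  ext; simp [block]

theorem block_add (X Y : HTensor A R →L[ℂ] HTensor A R) (e f : R) :
    block (X + Y) e f = block X e f + block Y e f := by
  ext; simp [block]

theorem IsTensorIdImage.sub {Φ : traceClass A →ₗ[ℂ] traceClass A} {X X' : traceClass (HTensor A R)}
    {Y Y' : HTensor A R →L[ℂ] HTensor A R} (h : IsTensorIdImage Φ X Y)
    (h' : IsTensorIdImage Φ X' Y') : IsTensorIdImage Φ (X - X') (Y - Y') := by
  intro e f
  rw [block_sub, h e f, h' e f, ← Submodule.coe_sub, ← map_sub]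
  congr 2
  exact Subtype.ext (block_sub _ _ e f).symm

/-- Images subtract. If one of them does not exist, its infimum is over the empty set and the right
side is `∞`. -/
theorem tensorIdTraceNorm_sub_le (Φ : traceClass A →ₗ[ℂ] traceClass A)
    (X X' : traceClass (HTensor A R)) :
    tensorIdTraceNorm Φ (X - X') ≤ tensorIdTraceNorm Φ X + tensorIdTraceNorm Φ X' := by
  conv_rhs => rw [tensorIdTraceNorm, tensorIdTraceNorm]
  simp_rw [ENNReal.iInf_add, ENNReal.add_iInf]
  refine le_iInf fun Y => le_iInf fun hY => le_iInf fun Y' => le_iInf fun hY' => ?_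
  exact (iInf₂_le (Y - Y') (hY.sub hY')).trans (traceNorm_sub_le Y Y')

theorem mem_traceClass_of_isPositive {H : Type*} [NormedAddCommGroup H] [InnerProductSpace ℂ H]
    {T : H →L[ℂ] H} (hT : T.IsPositive) (hfin : posTrace T < ∞) : T ∈ traceClass H :=
  Submodule.subset_span ⟨hT, hfin⟩

/-- If `Y` is up to a factor `c` the compression of `Z` by an isometry `I ⊗ V`, at the level of
blocks, then `(Φ ⊗ Id)(Y)` is controlled by `(Φ ⊗ Id)(Z)`. -/
theorem tensorIdTraceNorm_le_of_block_eq {S : Type*} [NormedAddCommGroup S]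
    [InnerProductSpace ℂ S] (Φ : traceClass A →ₗ[ℂ] traceClass A) {c : ℝ} (hc : 0 < c)
    (V : R →ₗᵢ[ℂ] S) (Y : traceClass (HTensor A R)) (Z : traceClass (HTensor A S))
    (h : ∀ e f : R, block (Y : HTensor A R →L[ℂ] HTensor A R) e f =
      (c : ℂ) • block (Z : HTensor A S →L[ℂ] HTensor A S) (V e) (V f)) :
    tensorIdTraceNorm Φ Y ≤ ENNReal.ofReal c * tensorIdTraceNorm Φ Z := by
  obtain ⟨W, hW⟩ := exists_isometry_tensorKet A V
  have hc0 : ENNReal.ofReal c ≠ 0 := by simpa using hc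
  conv_rhs => rw [tensorIdTraceNorm]
  simp_rw [ENNReal.mul_iInf_of_ne hc0 ENNReal.ofReal_ne_top]
  refine le_iInf fun Z' => le_iInf fun hZ' => ?_
  have himg : IsTensorIdImage Φ Y ((c : ℂ) •
      (ContinuousLinearMap.adjoint W.toContinuousLinearMap).comp
        (Z'.comp W.toContinuousLinearMap)) := by
    intro e f
    have h1 : block ((ContinuousLinearMap.adjoint W.toContinuousLinearMap).comp
        (Z'.comp W.toContinuousLinearMap)) e f = block Z' (V e) (V f) := by
      refine ContinuousLinearMap.ext fun x => ext_inner_left ℂ fun y => ?_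
      rw [inner_block, inner_block, ← hW, ← hW, ContinuousLinearMap.comp_apply,
        ContinuousLinearMap.adjoint_inner_right]
      rfl
    have h2 : (⟨block (Y : HTensor A R →L[ℂ] HTensor A R) e f, block_mem_traceClass Y.2 e f⟩ :
        traceClass A) = (c : ℂ) • ⟨block (Z : HTensor A S →L[ℂ] HTensor A S) (V e) (V f),
          block_mem_traceClass Z.2 (V e) (V f)⟩ := Subtype.ext (h e f)
    rw [block_smul, h1, hZ' (V e) (V f), h2, Φ.map_smul, Submodule.coe_smul]
  refine (iInf₂_le _ himg).trans ?_
  rw [traceNorm_smul hc.le]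
  gcongr
  exact traceNorm_isometry_compression_le W _

/-- The energy-constrained diamond norm controls all positive operators of trace at most `c` and
energy at most `c E`, on any separable extension. -/
theorem tensorIdTraceNorm_le_ecDiamondNorm {ι : Type*} [Countable ι] [CompleteSpace R]
    (fock : HilbertBasis ℕ ℂ A) (b : HilbertBasis ι ℂ R) (Φ : traceClass A →ₗ[ℂ] traceClass A)
    {c E : ℝ} (hc : 0 < c) (Y : traceClass (HTensor A R))
    (hY : (Y : HTensor A R →L[ℂ] HTensor A R).IsPositive)
    (htr : posTrace (Y : HTensor A R →L[ℂ] HTensor A R) ≤ ENNReal.ofReal c)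
    (hen : weightedTrace fock b (fun n => (n : ℝ≥0∞)) (Y : HTensor A R →L[ℂ] HTensor A R) ≤
      ENNReal.ofReal c * ENNReal.ofReal E) :
    tensorIdTraceNorm Φ Y ≤ ENNReal.ofReal c * ecDiamondNorm fock E Φ := by
  classical
  obtain ⟨j₀, hj₀⟩ := exists_injective_nat ι
  -- The shift by one keeps `fock 0` of the reference copy orthogonal to the embedded `R`, as room
  -- for the padding state.
  have hj : Function.Injective fun i => j₀ i + 1 := (add_left_injective 1).comp hj₀
  obtain ⟨V, hV⟩ := fock.exists_isometry b hj
  obtain ⟨W, hW⟩ := exists_isometry_tensorKet A V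
  obtain ⟨Y₀, hY₀⟩ := Y
  simp only at hY htr hen
  set T : HTensor A A →L[ℂ] HTensor A A := W.toContinuousLinearMap.comp
    (Y₀.comp (ContinuousLinearMap.adjoint W.toContinuousLinearMap)) with hT
  have hTpos : T.IsPositive := hY.conj_adjoint _
  have hTw : ∀ w, weightedTrace fock fock w T = weightedTrace fock b w Y₀ := fun w =>
    weightedTrace_conj_isometry fock b fock w hj hV hW Y₀
  have hTtr : posTrace T = posTrace Y₀ := by
    rw [posTrace_eq_weightedTrace fock fock hTpos, hTw, posTrace_eq_weightedTrace fock b hY]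
  have hfin : posTrace Y₀ ≠ ∞ := ne_top_of_le_ne_top ENNReal.ofReal_ne_top htr
  set v : HTensor A A := tensorKet A (fock 0) (fock 0) with hv
  set N : HTensor A A →L[ℂ] HTensor A A := InnerProductSpace.rankOne ℂ v v with hN
  have hNpos : N.IsPositive := InnerProductSpace.isPositive_rankOne_self v
  have hNw : ∀ w, weightedTrace fock fock w N = w 0 := fun w =>
    weightedTrace_rankOne_tensorKet w 0 0
  -- The missing trace, to be placed on `N`. Its first factor is the vacuum, so the energy is
  -- unchanged, and dividing by `c` gives a genuine state of energy at most `E`.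
  set t : ℝ := c - (posTrace Y₀).toReal with ht
  have ht0 : 0 ≤ t := sub_nonneg.mpr (ENNReal.toReal_le_of_le_ofReal hc.le htr)
  have htc : posTrace Y₀ + ENNReal.ofReal t = ENNReal.ofReal c := by
    conv_lhs => rw [← ENNReal.ofReal_toReal hfin]
    rw [← ENNReal.ofReal_add ENNReal.toReal_nonneg ht0, ht, add_sub_cancel]
  have htN : ((t : ℂ) • N).IsPositive := hNpos.smul_of_nonneg (by exact_mod_cast ht0)
  have hci : (0 : ℝ) ≤ c⁻¹ := inv_nonneg.mpr hc.le
  have hcc : ENNReal.ofReal c⁻¹ * ENNReal.ofReal c = 1 := by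
    rw [← ENNReal.ofReal_mul hci, inv_mul_cancel₀ hc.ne', ENNReal.ofReal_one]
  set Z : HTensor A A →L[ℂ] HTensor A A := ((c⁻¹ : ℝ) : ℂ) • (T + (t : ℂ) • N) with hZ
  have hZpos : Z.IsPositive := (hTpos.add htN).smul_of_nonneg (by exact_mod_cast hci)
  have hZw : ∀ w, weightedTrace fock fock w Z =
      ENNReal.ofReal c⁻¹ * (weightedTrace fock b w Y₀ + ENNReal.ofReal t * w 0) := fun w => by
    rw [hZ, weightedTrace_smul w hci, weightedTrace_add w hTpos htN, weightedTrace_smul w ht0,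
      hTw, hNw]
  have hZtr : posTrace Z = 1 := by
    rw [posTrace_eq_weightedTrace fock fock hZpos, hZw, ← posTrace_eq_weightedTrace fock b hY,
      Pi.one_apply, mul_one, htc, hcc]
  have hZfin : posTrace Z ≠ ∞ := by simp [hZtr]
  have hZmem : Z ∈ traceClass (HTensor A A) :=
    mem_traceClass_of_isPositive hZpos hZfin.lt_top
  have hZE : partialTrace fock Z ∈ energyStates fock E := by
    refine ⟨⟨isPositive_partialTrace fock fock hZpos hZfin, ?_⟩, ?_⟩
    · rw [posTrace_partialTrace fock fock hZpos hZfin, hZtr]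
    · rw [meanPhotonNumber_partialTrace fock fock hZpos hZfin, hZw, Nat.cast_zero, mul_zero,
        add_zero]
      calc _ ≤ ENNReal.ofReal c⁻¹ * (ENNReal.ofReal c * ENNReal.ofReal E) := by gcongr
        _ = _ := by rw [← mul_assoc, hcc, one_mul]
  have hV0 : ∀ r, ⟪fock 0, V r⟫_ℂ = 0 := fun r => by
    have : (innerSL ℂ (fock 0)).comp V.toContinuousLinearMap = 0 := b.clm_ext fun i => by
      simp [hV, orthonormal_iff_ite.mp fock.orthonormal]
    exact congrArg (fun f : R →L[ℂ] ℂ => f r) this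
  have hWW : ∀ x, ContinuousLinearMap.adjoint W.toContinuousLinearMap (W x) = x := fun x =>
    ext_inner_left ℂ fun y => by
      rw [ContinuousLinearMap.adjoint_inner_right]
      exact W.inner_map_map y x
  -- The padding is invisible here: its second factor `fock 0` is orthogonal to the range of `V`.
  have hblock : ∀ e f : R, block Y₀ e f = (c : ℂ) • block Z (V e) (V f) := by
    intro e f
    have hTb : block T (V e) (V f) = block Y₀ e f := by
      refine ContinuousLinearMap.ext fun x => ext_inner_left ℂ fun y => ?_
      rw [inner_block, inner_block, ← hW, ← hW, hT]
      change ⟪W _, W (Y₀ (ContinuousLinearMap.adjoint W.toContinuousLinearMap (W _)))⟫_ℂ = _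
      rw [W.inner_map_map, hWW]
    have hNb : block N (V e) (V f) = 0 := by
      refine ContinuousLinearMap.ext fun x => ext_inner_left ℂ fun y => ?_
      rw [inner_block, hN, InnerProductSpace.rankOne_apply, hv, inner_tensorKet, hV0]
      simp
    rw [hZ, block_smul, block_add, block_smul, hTb, hNb, smul_zero, add_zero, smul_smul,
      ← Complex.ofReal_mul, mul_inv_cancel₀ hc.ne', Complex.ofReal_one, one_smul]
  refine (tensorIdTraceNorm_le_of_block_eq Φ hc V ⟨Y₀, hY₀⟩ ⟨Z, hZmem⟩ hblock).trans ?_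
  gcongr
  exact le_iSup_of_le ⟨Z, hZmem⟩ (le_iSup₂_of_le ⟨hZpos, hZtr⟩ hZE le_rfl)

end TensorIdImage

/-! ### The energy projection and the algebra of the cutoff. -/

section Cutoff

variable {A R : Type*} [NormedAddCommGroup A] [InnerProductSpace ℂ A]
  [NormedAddCommGroup R] [InnerProductSpace ℂ R] {ι : Type*}

/-- Spectral projections of the first-factor observable `∑ n |n⟩⟨n|`. -/
theorem exists_diagonal_projection {κ : Type*} (e : HilbertBasis κ ℂ A) (b : HilbertBasis ι ℂ R)
    (low : κ → Prop) [DecidablePred low] :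
    ∃ P : HTensor A R →L[ℂ] HTensor A R, IsSelfAdjoint P ∧
      ∀ n i, P (tensorKet A (b i) (e n)) =
        ((if low n then 1 else 0 : ℝ) : ℂ) • tensorKet A (b i) (e n) := by
  classical
  set K : Submodule ℂ (HTensor A R) := (Submodule.span ℂ
    {x | ∃ n i, low n ∧ x = tensorKet A (b i) (e n)}).topologicalClosure with hK
  have : CompleteSpace K := (Submodule.isClosed_topologicalClosure _).completeSpace_coe
  refine ⟨K.starProjection, isSelfAdjoint_starProjection K, fun n i => ?_⟩
  by_cases h : low n
  · simp only [h, if_true, Complex.ofReal_one, one_smul]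
    exact Submodule.starProjection_eq_self_iff.mpr
      (Submodule.le_topologicalClosure _ (Submodule.subset_span ⟨n, i, h, rfl⟩))
  · simp only [h, if_false, Complex.ofReal_zero, zero_smul]
    refine K.starProjection_apply_eq_zero_iff.mpr ?_
    rw [hK, Submodule.orthogonal_closure, Submodule.mem_orthogonal]
    intro u hu
    induction hu using Submodule.span_induction with
    | mem x hx =>
      obtain ⟨m, l, hm, rfl⟩ := hx
      have hne : m ≠ n := fun h' => h (h' ▸ hm)
      rw [inner_tensorKet, orthonormal_iff_ite.mp e.orthonormal, if_neg hne, zero_mul]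
    | zero => exact inner_zero_left _
    | add x y _ _ hx hy => rw [inner_add_left, hx, hy, add_zero]
    | smul c x _ hx => rw [inner_smul_left, hx, mul_zero]

/-- In the off-diagonal blocks the factors `t` and `t⁻¹` cancel, so only the two diagonal blocks
need correction. For positive `T` and `t = √ε` with `ε < 1`, self-adjoint `P` makes each conjugated
term positive, so the right side becomes a difference of positive operators. -/
theorem conj_sub_conj_eq {𝔄 : Type*} [Ring 𝔄] [Algebra ℂ 𝔄] (P T : 𝔄) {t : ℂ} (ht : t ≠ 0) :
    (t • P + t⁻¹ • (1 - P)) * T * (t • P + t⁻¹ • (1 - P)) - (t ^ 2) • (P * T * P)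
      - ((t ^ 2)⁻¹ - 1) • ((1 - P) * T * (1 - P)) = T - P * T * P := by
  have hT : T = P * T * P + P * T * (1 - P) + (1 - P) * T * P + (1 - P) * T * (1 - P) := by
    noncomm_ring
  set Q := 1 - P
  have h1 : (t • P + t⁻¹ • Q) * T * (t • P + t⁻¹ • Q) =
      (t ^ 2) • (P * T * P) + P * T * Q + Q * T * P + (t ^ 2)⁻¹ • (Q * T * Q) := by
    simp only [add_mul, mul_add, smul_mul_assoc, mul_smul_comm, smul_add, smul_smul, inv_mul_cancel₀ ht,
      mul_inv_cancel₀ ht, one_smul, sq, mul_inv]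
    abel
  have h2 : T - P * T * P = P * T * Q + Q * T * P + Q * T * Q := by
    rw [sub_eq_iff_eq_add]
    refine hT.trans ?_
    abel
  rw [h1, h2]
  module

end Cutoff

/-! ### Trace and energy estimates after the cutoff. -/

section EnergyCutoff

variable {A R : Type*} [NormedAddCommGroup A] [InnerProductSpace ℂ A]
  [NormedAddCommGroup R] [InnerProductSpace ℂ R] {ι : Type*}

theorem ContinuousLinearMap.IsPositive.conj_isSelfAdjoint {H : Type*} [NormedAddCommGroup H]
    [InnerProductSpace ℂ H] [CompleteSpace H] {T D : H →L[ℂ] H} (hT : T.IsPositive)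
    (hD : IsSelfAdjoint D) : (D * T * D).IsPositive := by
  have h := hT.conj_adjoint D
  rw [hD.adjoint_eq] at h
  exact h

theorem isSelfAdjoint_one_sub {H : Type*} [NormedAddCommGroup H] [InnerProductSpace ℂ H]
    [CompleteSpace H] {P : H →L[ℂ] H} (hP : IsSelfAdjoint P) : IsSelfAdjoint (1 - P) :=
  (IsSelfAdjoint.one _).sub hP

theorem isSelfAdjoint_smul_add_inv_smul {H : Type*} [NormedAddCommGroup H]
    [InnerProductSpace ℂ H] [CompleteSpace H] {P Q : H →L[ℂ] H} (t : ℝ) (hP : IsSelfAdjoint P)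
    (hQ : IsSelfAdjoint Q) : IsSelfAdjoint ((t : ℂ) • P + (t : ℂ)⁻¹ • Q) := by
  refine (IsSelfAdjoint.smul ?_ hP).add (IsSelfAdjoint.smul ?_ hQ)
  · exact Complex.conj_ofReal _
  · rw [← Complex.ofReal_inv]
    exact Complex.conj_ofReal _

/-- A weight bounded by `α + β n` has expectation at most `α + β E` in a state of energy `E`. -/
theorem weightedTrace_le_of_affine {fock : HilbertBasis ℕ ℂ A} {b : HilbertBasis ι ℂ R}
    {ρ : HTensor A R →L[ℂ] HTensor A R} {E : ℝ} (hE : 0 ≤ E) (h1 : weightedTrace fock b 1 ρ ≤ 1)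
    (h2 : weightedTrace fock b (fun n => (n : ℝ≥0∞)) ρ ≤ ENNReal.ofReal E)
    {w : ℕ → ℝ≥0∞} {α β : ℝ} (hα : 0 ≤ α) (hβ : 0 ≤ β)
    (hw : ∀ n : ℕ, w n ≤ ENNReal.ofReal (α + β * n)) :
    weightedTrace fock b w ρ ≤ ENNReal.ofReal (α + β * E) := by
  have hw' : w ≤ ENNReal.ofReal α • (1 : ℕ → ℝ≥0∞) +
      ENNReal.ofReal β • (fun n : ℕ => (n : ℝ≥0∞)) := by
    intro n
    refine (hw n).trans (le_of_eq ?_)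
    rw [ENNReal.ofReal_add hα (by positivity), ENNReal.ofReal_mul hβ]
    simp
  refine (weightedTrace_mono hw' ρ).trans ?_
  rw [weightedTrace_weight_add, weightedTrace_weight_smul, weightedTrace_weight_smul,
    ENNReal.ofReal_add hα (by positivity), ENNReal.ofReal_mul hβ]
  gcongr
  exact mul_le_of_le_one_right' h1

/-- Trace and energy of the positive operators that make up a difference of two states of energy
`E` after a cutoff at energy `E / ε ^ 2`. -/
theorem cutoff_bounds (fock : HilbertBasis ℕ ℂ A) (b : HilbertBasis ι ℂ R)
    {E ε : ℝ} (hE : 0 < E) (hε0 : 0 < ε) (hε1 : ε < 1) {P : HTensor A R →L[ℂ] HTensor A R}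
    (hPsa : IsSelfAdjoint P)
    (hP : ∀ n i, P (tensorKet A (b i) (fock n)) =
      ((if (n : ℝ) ≤ E / ε ^ 2 then 1 else 0 : ℝ) : ℂ) • tensorKet A (b i) (fock n))
    {X ρ σ : HTensor A R →L[ℂ] HTensor A R} (hX : X.IsPositive) (hρ : ρ.IsPositive)
    (hσ : σ.IsPositive) (hX1 : posTrace X ≤ ENNReal.ofReal ε)
    (hρ1 : posTrace ρ ≤ 1) (hσ1 : posTrace σ ≤ 1)
    (hρE : weightedTrace fock b (fun n => (n : ℝ≥0∞)) ρ ≤ ENNReal.ofReal E)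
    (hσE : weightedTrace fock b (fun n => (n : ℝ≥0∞)) σ ≤ ENNReal.ofReal E)
    {Y : HTensor A R →L[ℂ] HTensor A R}
    (hY : Y = P * X * P + ((√ε : ℂ) • P + (√ε : ℂ)⁻¹ • (1 - P)) * ρ *
      ((√ε : ℂ) • P + (√ε : ℂ)⁻¹ • (1 - P)) + (ε : ℂ) • (P * σ * P)
      + ((ε⁻¹ - 1 : ℝ) : ℂ) • ((1 - P) * σ * (1 - P))) :
    Y.IsPositive ∧ posTrace Y ≤ ENNReal.ofReal (5 * ε) ∧
      weightedTrace fock b (fun n => (n : ℝ≥0∞)) Y ≤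
        ENNReal.ofReal (5 * ε) * ENNReal.ofReal (E / ε ^ 2) := by
  have hs0 : 0 < √ε := Real.sqrt_pos.mpr hε0
  have hs2 : √ε ^ 2 = ε := Real.sq_sqrt hε0.le
  have hεi : 1 ≤ ε⁻¹ := (one_le_inv₀ hε0).mpr hε1.le
  have hd : 0 ≤ ε⁻¹ - 1 := sub_nonneg.mpr hεi
  set Q : HTensor A R →L[ℂ] HTensor A R := 1 - P with hQdef
  set K : HTensor A R →L[ℂ] HTensor A R := (√ε : ℂ) • P + (√ε : ℂ)⁻¹ • Q with hKdef
  have hQsa : IsSelfAdjoint Q := isSelfAdjoint_one_sub hPsa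
  have hKsa : IsSelfAdjoint K := isSelfAdjoint_smul_add_inv_smul (√ε) hPsa hQsa
  have hQ : ∀ n i, Q (tensorKet A (b i) (fock n)) =
      ((if (n : ℝ) ≤ E / ε ^ 2 then 0 else 1 : ℝ) : ℂ) • tensorKet A (b i) (fock n) := by
    intro n i
    rw [hQdef, sub_apply, hP]
    split_ifs <;> simp
  have hK : ∀ n i, K (tensorKet A (b i) (fock n)) =
      ((if (n : ℝ) ≤ E / ε ^ 2 then √ε else (√ε)⁻¹ : ℝ) : ℂ) • tensorKet A (b i) (fock n) := by
    intro n i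
    rw [hKdef, add_apply, smul_apply, smul_apply, hP, hQ]
    split_ifs <;> simp
  have hPX := hX.conj_isSelfAdjoint hPsa
  have hKρ := hρ.conj_isSelfAdjoint hKsa
  have hPσ : ((ε : ℂ) • (P * σ * P)).IsPositive :=
    (hσ.conj_isSelfAdjoint hPsa).smul_of_nonneg (by exact_mod_cast hε0.le)
  have hQσ : (((ε⁻¹ - 1 : ℝ) : ℂ) • (Q * σ * Q)).IsPositive :=
    (hσ.conj_isSelfAdjoint hQsa).smul_of_nonneg (by exact_mod_cast hd)
  have hYpos : Y.IsPositive := hY ▸ ((hPX.add hKρ).add hPσ).add hQσ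
  have hYw : ∀ w : ℕ → ℝ≥0∞, weightedTrace fock b w Y = _ := fun w => by
    rw [hY, weightedTrace_add w ((hPX.add hKρ).add hPσ) hQσ, weightedTrace_add w (hPX.add hKρ) hPσ,
      weightedTrace_add w hPX hKρ, weightedTrace_smul w hε0.le, weightedTrace_smul w hd,
      weightedTrace_conj_diagonal w hPsa hP, weightedTrace_conj_diagonal w hKsa hK,
      weightedTrace_conj_diagonal w hPsa hP, weightedTrace_conj_diagonal w hQsa hQ]
  rw [posTrace_eq_weightedTrace fock b hρ] at hρ1
  rw [posTrace_eq_weightedTrace fock b hσ] at hσ1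
  rw [posTrace_eq_weightedTrace fock b hX] at hX1
  -- Markov's inequality at the level of weights: the indicator of high levels is at most `ε ^ 2 / E
  -- * n`, whose expectation is at most `ε ^ 2`.
  have hhigh : ∀ n : ℕ, ¬ (n : ℝ) ≤ E / ε ^ 2 → 1 ≤ ε ^ 2 / E * n := by
    intro n hn
    rw [not_le, div_lt_iff₀ (by positivity)] at hn
    rw [div_mul_eq_mul_div, le_div_iff₀ hE]
    linarith
  refine ⟨hYpos, ?_, ?_⟩
  · rw [posTrace_eq_weightedTrace fock b hYpos, hYw]
    have b1 : weightedTrace fock b (fun n => (1 : ℕ → ℝ≥0∞) n *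
        ENNReal.ofReal ((if (n : ℝ) ≤ E / ε ^ 2 then 1 else 0) ^ 2)) X ≤ ENNReal.ofReal ε := by
      refine (weightedTrace_mono (fun n => ?_) X).trans hX1
      dsimp only
      split_ifs <;> simp
    -- Low levels carry the factor `ε`; high levels carry `ε⁻¹` against a tail of at most `ε ^ 2`.
    -- Both contributions are at most `ε`.
    have b2 : weightedTrace fock b (fun n => (1 : ℕ → ℝ≥0∞) n *
        ENNReal.ofReal ((if (n : ℝ) ≤ E / ε ^ 2 then √ε else (√ε)⁻¹) ^ 2)) ρ ≤
        ENNReal.ofReal (ε + ε / E * E) := by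
      refine weightedTrace_le_of_affine hE.le hρ1 hρE hε0.le (by positivity) fun n => ?_
      rw [Pi.one_apply, one_mul]
      refine ENNReal.ofReal_le_ofReal ?_
      split_ifs with h
      · rw [hs2]
        exact le_add_of_nonneg_right (by positivity)
      · rw [inv_pow, hs2]
        have h1 := mul_le_mul_of_nonneg_left (hhigh n h) (inv_nonneg.mpr hε0.le)
        have h2 : ε⁻¹ * (ε ^ 2 / E * n) = ε / E * n := by field_simp
        rw [h2] at h1
        linarith
    have b3 : weightedTrace fock b (fun n => (1 : ℕ → ℝ≥0∞) n *
        ENNReal.ofReal ((if (n : ℝ) ≤ E / ε ^ 2 then 1 else 0) ^ 2)) σ ≤ ENNReal.ofReal 1 := by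
      rw [ENNReal.ofReal_one]
      refine (weightedTrace_mono (fun n => ?_) σ).trans hσ1
      dsimp only
      split_ifs <;> simp
    have b4 : weightedTrace fock b (fun n => (1 : ℕ → ℝ≥0∞) n *
        ENNReal.ofReal ((if (n : ℝ) ≤ E / ε ^ 2 then 0 else 1) ^ 2)) σ ≤
        ENNReal.ofReal (0 + ε ^ 2 / E * E) := by
      refine weightedTrace_le_of_affine hE.le hσ1 hσE le_rfl (by positivity) fun n => ?_
      rw [Pi.one_apply, one_mul]
      refine ENNReal.ofReal_le_ofReal ?_
      split_ifs with h
      · rw [zero_pow two_ne_zero]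
        positivity
      · linarith [hhigh n h]
    refine (add_le_add (add_le_add (add_le_add b1 b2) (mul_le_mul_right b3 _))
      (mul_le_mul_right b4 _)).trans ?_
    rw [← ENNReal.ofReal_mul hε0.le, ← ENNReal.ofReal_mul hd,
      ← ENNReal.ofReal_add (by positivity) (by positivity),
      ← ENNReal.ofReal_add (by positivity) (by positivity),
      ← ENNReal.ofReal_add (by positivity) (by positivity)]
    refine ENNReal.ofReal_le_ofReal ?_
    -- The four terms cost `ε`, `2 * ε`, `ε` and `ε - ε ^ 2`; this is the origin of the constant
    -- `5`.
    have h : ε + (ε + ε / E * E) + ε * 1 + (ε⁻¹ - 1) * (0 + ε ^ 2 / E * E) =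
        5 * ε - ε ^ 2 := by
      field_simp
      ring
    rw [h]
    nlinarith
  · rw [hYw]
    -- No energy bound is available for `X`; the cutoff replaces it, since `n ≤ E / ε ^ 2` on the
    -- range of `P`.
    have b1 : weightedTrace fock b (fun n => (n : ℝ≥0∞) *
        ENNReal.ofReal ((if (n : ℝ) ≤ E / ε ^ 2 then 1 else 0) ^ 2)) X ≤
        ENNReal.ofReal (E / ε ^ 2 * ε) := by
      rw [ENNReal.ofReal_mul (by positivity)]
      refine (weightedTrace_mono (w' := ENNReal.ofReal (E / ε ^ 2) • (1 : ℕ → ℝ≥0∞))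
        (fun n => ?_) X).trans ?_
      · dsimp only
        split_ifs with h
        · rw [← ENNReal.ofReal_natCast]
          simpa using ENNReal.ofReal_le_ofReal h
        · simp
      · rw [weightedTrace_weight_smul]
        gcongr
    -- For the states no tail estimate is needed: a diagonal conjugation multiplies the energy by at
    -- most `β`, which is `ε⁻¹` for `K` and `1` for `P` and `Q`.
    have affine : ∀ {τ : HTensor A R →L[ℂ] HTensor A R} {β : ℝ} {k : ℕ → ℝ}, 0 ≤ β →
        weightedTrace fock b 1 τ ≤ 1 →
        weightedTrace fock b (fun n => (n : ℝ≥0∞)) τ ≤ ENNReal.ofReal E →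
        (∀ n, k n ^ 2 ≤ β) →
        weightedTrace fock b (fun n => (n : ℝ≥0∞) * ENNReal.ofReal (k n ^ 2)) τ ≤
          ENNReal.ofReal (0 + β * E) := by
      intro τ β k hβ h1 hE' hk
      refine weightedTrace_le_of_affine hE.le h1 hE' le_rfl hβ fun n => ?_
      rw [← ENNReal.ofReal_natCast, ← ENNReal.ofReal_mul n.cast_nonneg]
      refine ENNReal.ofReal_le_ofReal ?_
      rw [zero_add, mul_comm]
      exact mul_le_mul_of_nonneg_right (hk n) n.cast_nonneg
    have b2 := affine (k := fun n : ℕ => if (n : ℝ) ≤ E / ε ^ 2 then √ε else (√ε)⁻¹)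
      (inv_nonneg.mpr hε0.le) hρ1 hρE fun n => by
        split_ifs
        · rw [hs2]
          linarith
        · rw [inv_pow, hs2]
    have b3 := affine (k := fun n : ℕ => if (n : ℝ) ≤ E / ε ^ 2 then 1 else 0)
      zero_le_one hσ1 hσE fun n => by
        split_ifs <;> norm_num
    have b4 := affine (k := fun n : ℕ => if (n : ℝ) ≤ E / ε ^ 2 then 0 else 1)
      zero_le_one hσ1 hσE fun n => by
        split_ifs <;> norm_num
    refine (add_le_add (add_le_add (add_le_add b1 b2) (mul_le_mul_right b3 _))
      (mul_le_mul_right b4 _)).trans ?_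
    rw [← ENNReal.ofReal_mul hε0.le, ← ENNReal.ofReal_mul hd,
      ← ENNReal.ofReal_add (by positivity) (by positivity),
      ← ENNReal.ofReal_add (by positivity) (by positivity),
      ← ENNReal.ofReal_add (by positivity) (by positivity),
      ← ENNReal.ofReal_mul (by positivity)]
    refine ENNReal.ofReal_le_ofReal ?_
    have h : 5 * ε * (E / ε ^ 2) - (E / ε ^ 2 * ε + (0 + ε⁻¹ * E) + ε * (0 + 1 * E)
        + (ε⁻¹ - 1) * (0 + 1 * E)) = (2 * ε⁻¹ + 1 - ε) * E := by
      field_simp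
      ring
    have h' : 0 ≤ (2 * ε⁻¹ + 1 - ε) * E := mul_nonneg (by linarith) hE.le
    linarith

end EnergyCutoff

/-! ### Jordan decomposition of the difference and conclusion. -/

/-- The positive and negative parts of a difference of states have equal trace. -/
theorem exists_sub_eq_sub_posTrace_le {H : Type*} [NormedAddCommGroup H] [InnerProductSpace ℂ H]
    [CompleteSpace H] {ρ σ : H →L[ℂ] H} (hρ : IsDensity ρ) (hσ : IsDensity σ) {ε : ℝ}
    (h : traceNorm (ρ - σ) ≤ ENNReal.ofReal (2 * ε)) :
    ∃ X Y : H →L[ℂ] H, X.IsPositive ∧ Y.IsPositive ∧ ρ - σ = X - Y ∧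
      posTrace X ≤ ENNReal.ofReal ε ∧ posTrace Y ≤ ENNReal.ofReal ε := by
  have hsa : IsSelfAdjoint (ρ - σ) := hρ.1.isSelfAdjoint.sub hσ.1.isSelfAdjoint
  have hX : ((ρ - σ)⁺).IsPositive :=
    (ContinuousLinearMap.nonneg_iff_isPositive _).mp (CFC.posPart_nonneg _)
  have hY : ((ρ - σ)⁻).IsPositive :=
    (ContinuousLinearMap.nonneg_iff_isPositive _).mp (CFC.negPart_nonneg _)
  have hsub : (ρ - σ)⁺ - (ρ - σ)⁻ = ρ - σ := CFC.posPart_sub_negPart _ hsa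
  have habs : (ρ - σ)⁺ + (ρ - σ)⁻ = CFC.abs (ρ - σ) := CFC.posPart_add_negPart _ hsa
  have htr : posTrace (ρ - σ)⁺ = posTrace (ρ - σ)⁻ := by
    -- An identity between sums of positive operators, so that additivity of the `[0, ∞]`-valued
    -- trace applies and the two unit traces cancel.
    have h1 : (ρ - σ)⁺ + σ = (ρ - σ)⁻ + ρ := by
      rw [sub_eq_sub_iff_add_eq_add] at hsub
      rw [hsub, add_comm]
    have h2 := congrArg posTrace h1
    rw [posTrace_add hX hσ.1, posTrace_add hY hρ.1, hρ.2, hσ.2] at h2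
    exact (ENNReal.add_left_inj ENNReal.one_ne_top).mp h2
  have hle : posTrace (ρ - σ)⁺ ≤ ENNReal.ofReal ε := by
    have h3 : posTrace (ρ - σ)⁺ + posTrace (ρ - σ)⁻ ≤ ENNReal.ofReal (2 * ε) := by
      rw [← posTrace_add hX hY, habs]
      exact h
    rw [← htr, ← two_mul, ENNReal.ofReal_mul zero_le_two, ENNReal.ofReal_ofNat] at h3
    exact (ENNReal.mul_le_mul_iff_right two_ne_zero ENNReal.ofNat_ne_top).mp h3
  exact ⟨_, _, hX, hY, hsub.symm, hle, htr ▸ hle⟩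

theorem mainTheorem3
    {A R ι : Type*} [NormedAddCommGroup A] [InnerProductSpace ℂ A] [CompleteSpace A]
    [NormedAddCommGroup R] [InnerProductSpace ℂ R] [CompleteSpace R] [Countable ι]
    (fock : HilbertBasis ℕ ℂ A) (b : HilbertBasis ι ℂ R)
    (E ε : ℝ) (hE : 0 < E) (hε0 : 0 < ε) (hε1 : ε < 1)
    (ρ σ : traceClass (HTensor A R))
    (hρ : IsDensity (ρ : HTensor A R →L[ℂ] HTensor A R))
    (hσ : IsDensity (σ : HTensor A R →L[ℂ] HTensor A R))
    (hρE : partialTrace b (ρ : HTensor A R →L[ℂ] HTensor A R) ∈ energyStates fock E)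
    (hσE : partialTrace b (σ : HTensor A R →L[ℂ] HTensor A R) ∈ energyStates fock E)
    (hρσ : traceNorm ((ρ : HTensor A R →L[ℂ] HTensor A R) - (σ : HTensor A R →L[ℂ] HTensor A R))
      ≤ ENNReal.ofReal (2 * ε))
    (Φ : traceClass A →ₗ[ℂ] traceClass A) (hΦ : IsHermitianPreserving Φ) :
    tensorIdTraceNorm Φ (ρ - σ) ≤ ENNReal.ofReal (10 * ε) * ecDiamondNorm fock (E / ε ^ 2) Φ := by
  classical
  obtain ⟨r, hr⟩ := ρ
  obtain ⟨s, hs⟩ := σ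
  simp only at hρ hσ hρE hσE hρσ
  obtain ⟨X, X', hX, hX', hXX', hX1, hX1'⟩ := exists_sub_eq_sub_posTrace_le hρ hσ hρσ
  obtain ⟨P, hPsa, hP⟩ :=
    exists_diagonal_projection fock b fun n : ℕ => (n : ℝ) ≤ E / ε ^ 2
  have hrE := hρE.2
  rw [meanPhotonNumber_partialTrace fock b hρ.1 (by simp [hρ.2])] at hrE
  have hsE := hσE.2
  rw [meanPhotonNumber_partialTrace fock b hσ.1 (by simp [hσ.2])] at hsE
  obtain ⟨hY, hYtr, hYE⟩ := cutoff_bounds fock b hE hε0 hε1 hPsa hP hX hρ.1 hσ.1 hX1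
    hρ.2.le hσ.2.le hrE hsE rfl
  -- The roles of the states are exchanged: the corrections subtracted from `K * ρ * K` become
  -- positive summands of the second operator, and vice versa.
  obtain ⟨hY', hYtr', hYE'⟩ := cutoff_bounds fock b hE hε0 hε1 hPsa hP hX' hσ.1 hρ.1 hX1'
    hσ.2.le hρ.2.le hsE hrE rfl
  have hYm := mem_traceClass_of_isPositive hY (hYtr.trans_lt ENNReal.ofReal_lt_top)
  have hYm' := mem_traceClass_of_isPositive hY' (hYtr'.trans_lt ENNReal.ofReal_lt_top)
  have hdec : (⟨r, hr⟩ - ⟨s, hs⟩ : traceClass (HTensor A R)) = ⟨_, hYm⟩ - ⟨_, hYm'⟩ := by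
    refine Subtype.ext ?_
    change r - s = _ - _
    have ht : (√ε : ℂ) ≠ 0 := by exact_mod_cast (Real.sqrt_pos.mpr hε0).ne'
    have ht2 : (√ε : ℂ) ^ 2 = (ε : ℂ) := by exact_mod_cast Real.sq_sqrt hε0.le
    have h1 := conj_sub_conj_eq P r ht
    have h2 := conj_sub_conj_eq P s ht
    -- Below the cutoff the states are replaced by the Jordan parts; the other blocks come from
    -- `conj_sub_conj_eq` applied to each state.
    have h3 : P * r * P - P * s * P = P * X * P - P * X' * P := by
      rw [← sub_mul, ← mul_sub, hXX', mul_sub, sub_mul]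
    rw [ht2] at h1 h2
    push_cast
    rw [sub_eq_iff_eq_add] at h1 h2
    rw [sub_eq_iff_eq_add.mp h1, sub_eq_iff_eq_add.mp h2]
    rw [sub_eq_iff_eq_add] at h3
    rw [h3]
    module
  rw [hdec]
  have hc : (0 : ℝ) < 5 * ε := by positivity
  refine (tensorIdTraceNorm_sub_le Φ _ _).trans ((add_le_add
    (tensorIdTraceNorm_le_ecDiamondNorm fock b Φ hc ⟨_, hYm⟩ hY hYtr hYE)
    (tensorIdTraceNorm_le_ecDiamondNorm fock b Φ hc ⟨_, hYm'⟩ hY' hYtr' hYE')).trans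
    (le_of_eq ?_))
  rw [← add_mul, ← ENNReal.ofReal_add hc.le hc.le]
  congr 2
  ring
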